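/- **Setting.** Consider the plant $\dot x = Ax + Bu$, $x(t)\in\mathbb R^n$ (no unknown input, $v\equiv 0$), driven by $N_c$ controller nodes, $Bu=\sum_{\iota=1}^{N_c}B^\iota u^\iota$, and observed by $N$ observer nodes. Node $i$ measures $y_i=C_ix$ ($C_i$ of full row rank $p_i$) and receives some input $u_i$, a linear function of $u^1,\dots,u^{N_c}$, such that $Bu=B_iu_i+B_{-i}u_{-i}$ with $B_{-i}$ of full column rank; $u_{-i}$ is not available to node $i$. The observer nodes communicate over an undirected graph with symmetric weights $a_{ij}\ge 0$, where $a_{ij}>0$ exactly on the edges, and without self-loops. **Observers.** For each $i$ let $\delta_i$ be the largest $\delta$ for which there are $T_{id}\in\mathbb R^{n\times\delta}$, $E_i\in\mathbb R^{\delta\times\delta}$, $F_i,G_i\in\mathbb R^{\delta\times p_i}$ with $$T_{id}^\top T_{id}=I,\quad G_iC_iB_{-i}=T_{id}^\top B_{-i},\quad E_iT_{id}^\top+(G_iC_i-T_{id}^\top)A+(F_i-E_iG_i)C_i=0,$$ and either all eigenvalues of $E_i$ have negative real part, or $\delta=p_i$, $E_i=0$, $F_i=0$, $G_iC_i=T_{id}^\top$.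 Fix such matrices for $\delta=\delta_i$, and $T_{iu}\in\mathbb R^{n\times(n-\delta_i)}$ with $T_{id}^\top T_{iu}=0$, $T_{iu}^\top T_{iu}=I$, $T_{iu}T_{iu}^\top=I-T_{id}T_{id}^\top$. Put $\bar G_i=T_{id}G_i$, $\bar E_i=T_{id}E_iT_{id}^\top+T_{iu}T_{iu}^\top A$, $\bar F_i=T_{id}F_i+T_{iu}T_{iu}^\top A\bar G_i$, $\bar B_i=(I-\bar G_iC_i)B_i$. Node $i$ runs $$\dot z_i=\bar E_iz_i+\bar F_iy_i+\bar B_iu_i-\gamma_iT_{iu}\varepsilon_{iu}-\gamma_{is}T_{iu}h(\varepsilon_{iu}),\quad z_i(0)=0,\qquad \hat x_i=z_i+\bar G_iy_i,$$ $$\varepsilon_{iu}=T_{iu}^\top\sum_{j=1}^Na_{ij}(\hat x_i-\hat x_j),\qquad \dot\gamma_i=\phi_i\|\varepsilon_{iu}\|^2,\quad \dot\gamma_{is}=\phi_{is}\|\varepsilon_{iu}\|,$$ with $\phi_i,\phi_{is},\gamma_i(0),\gamma_{is}(0)>0$, where $\|\cdot\|$ is the Euclidean norm and $h(\omega)=\omega/\|\omega\|$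 for $\omega\ne0$. Trajectories are locally absolutely continuous functions on $[0,\infty)$ satisfying the equations almost everywhere, where, as in Filippov's convention, $h(0)$ may be any vector of the closed unit ball (in particular $h(0)=0$ is allowed). **Theorem (distributed separation principle).** Assume that $(A,B)$ is stabilizable, that the communication graph is connected, and that $\sum_{i=1}^N\operatorname{Im}T_{id}=\mathbb R^n$ (collective strong detectability). Suppose that the linear state feedback $u^\iota=K^\iota x$, $\iota=1,\dots,N_c$, stabilizes the plant, i.e. every solution of $\dot x=Ax+\sum_\iota B^\iota K^\iota x$ tends to $0$. Let each controller node $\iota$ use the estimate of an arbitrary observer node $i'=i'(\iota)$, i.e. $u^\iota=K^\iota\hat x_{i'(\iota)}$. Then along every trajectory of the resulting closed loop, for every initial state $x(0)$, $$\lim_{t\to\infty}\|x(t)\|=0,\qquad \lim_{t\to\infty}\|\hat x_i(t)-x(t)\|=0\quad\text{for all } i,$$ and all adaptive gains $\gamma_i$, $\gamma_{is}$ remain bounded on $[0,\infty)$. -/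

import Mathlib

open Filter Topology MeasureTheory
open scoped Matrix

namespace DistObs

/-- Euclidean norm of a real column vector. -/
noncomputable def enorm2 {k : ℕ} (v : Fin k → ℝ) : ℝ :=
  ‖(WithLp.toLp 2 v : EuclideanSpace ℝ (Fin k))‖

/-- All (complex) eigenvalues of the real matrix `M` lie in the open left half plane. -/
def IsHurwitz {k : ℕ} (M : Matrix (Fin k) (Fin k) ℝ) : Prop :=
  ∀ μ ∈ spectrum ℂ (M.map (algebraMap ℝ ℂ)), μ.re < 0

/-- The pair `(A, B)` is stabilizable. -/
def IsStabilizable {n m : ℕ} (A : Matrix (Fin n) (Fin n) ℝ) (B : Matrix (Fin n) (Fin m) ℝ) :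
    Prop :=
  ∃ K : Matrix (Fin m) (Fin n) ℝ, IsHurwitz (A + B * K)

/-- The set-valued version of the direction map `ω ↦ ω / ‖ω‖` obtained by Filippov's convention:
the singleton `{ω / ‖ω‖}` for `ω ≠ 0`, and the closed unit ball (which contains the value `0`
of the single-valued convention `h 0 = 0`) for `ω = 0`. -/
noncomputable def direction {k : ℕ} (ω : Fin k → ℝ) : Set (Fin k → ℝ) :=
  {s | (ω ≠ 0 → s = (enorm2 ω)⁻¹ • ω) ∧ (ω = 0 → enorm2 s ≤ 1)}

/-- Weighted adjacency matrix of a connected undirected graph without self-loops on the nodes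
`Fin N`: `a i j > 0` on edges, `a i j = 0` otherwise. -/
def IsConnectedAdjacency {N : ℕ} (a : Matrix (Fin N) (Fin N) ℝ) : Prop :=
  (∀ i j, a i j = a j i) ∧
    ∃ G : SimpleGraph (Fin N), G.Connected ∧
      ∀ i j, (G.Adj i j → 0 < a i j) ∧ (¬ G.Adj i j → a i j = 0)

/-- `(T, E, F, G)` is a functional unknown-input observer for `Tᵀ x`, where
`x' = A x + B₋ u₋ + (known input)`, `y = C x` and `u₋` is unknown.  Either `E` is Hurwitz, or
the functional is read off directly from the output: `E = 0`, `F = 0` and `Tᵀ x = G y`. -/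
structure IsFunctionalObserver {n m p δ : ℕ} (A : Matrix (Fin n) (Fin n) ℝ)
    (Bm : Matrix (Fin n) (Fin m) ℝ) (C : Matrix (Fin p) (Fin n) ℝ)
    (T : Matrix (Fin n) (Fin δ) ℝ) (E : Matrix (Fin δ) (Fin δ) ℝ)
    (F : Matrix (Fin δ) (Fin p) ℝ) (G : Matrix (Fin δ) (Fin p) ℝ) : Prop where
  orthonormal : Tᵀ * T = 1
  decoupling : G * C * Bm = Tᵀ * Bm
  sylvester : E * Tᵀ + (G * C - Tᵀ) * A + (F - E * G) * C = 0
  stable : IsHurwitz E ∨ (δ = p ∧ E = 0 ∧ F = 0 ∧ G * C = Tᵀ)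

/-- `δ` is the largest dimension of a functional `Tᵀ x` for which such an observer exists. -/
def IsMaximalDim {n m p : ℕ} (A : Matrix (Fin n) (Fin n) ℝ)
    (Bm : Matrix (Fin n) (Fin m) ℝ) (C : Matrix (Fin p) (Fin n) ℝ) (δ : ℕ) : Prop :=
  IsGreatest {d : ℕ | ∃ (T : Matrix (Fin n) (Fin d) ℝ) (E : Matrix (Fin d) (Fin d) ℝ)
    (F : Matrix (Fin d) (Fin p) ℝ) (G : Matrix (Fin d) (Fin p) ℝ),
      IsFunctionalObserver A Bm C T E F G} δ

/-- Data of the plant `x' = A x + B u` (state dimension `n`, input dimension `m`), of `Nc`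
controller nodes and of `N` observer nodes with their communication graph. -/
structure Network (n m N Nc : ℕ) where
  /-- system matrix -/
  A : Matrix (Fin n) (Fin n) ℝ
  /-- input matrix -/
  B : Matrix (Fin n) (Fin m) ℝ
  /-- dimension of the input `u^ι` of controller node `ι` -/
  mc : Fin Nc → ℕ
  /-- input matrix `B^ι` of controller node `ι` -/
  Bc : ∀ ι, Matrix (Fin n) (Fin (mc ι)) ℝ
  /-- dimension of the output `y_i` measured by observer node `i` -/
  p : Fin N → ℕ
  /-- output matrix `C_i`, `y_i = C_i x` -/
  C : ∀ i, Matrix (Fin (p i)) (Fin n) ℝ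
  /-- dimension of the input `u_i` available to observer node `i` -/
  ml : Fin N → ℕ
  /-- the matrix `B_i` through which the available input `u_i` acts -/
  Bl : ∀ i, Matrix (Fin n) (Fin (ml i)) ℝ
  /-- controller-to-observer links: observer node `i` receives `u_i = ∑ ι, R i ι u^ι` -/
  R : ∀ i ι, Matrix (Fin (ml i)) (Fin (mc ι)) ℝ
  /-- dimension of the input `u_{-i}` not available to observer node `i` -/
  mm : Fin N → ℕ
  /-- the matrix `B_{-i}` through which the unavailable input `u_{-i}` acts -/
  Bm : ∀ i, Matrix (Fin n) (Fin (mm i)) ℝ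
  /-- weighted adjacency matrix of the graph of the observer nodes -/
  a : Matrix (Fin N) (Fin N) ℝ

namespace Network

variable {n m N Nc : ℕ} (S : Network n m N Nc)

/-- `∑ ι, B^ι u^ι`, the total effect of the controller nodes on the plant. -/
def inputTerm (u : ∀ ι, Fin (S.mc ι) → ℝ) : Fin n → ℝ :=
  ∑ ι, S.Bc ι *ᵥ u ι

/-- `u_i`, the input delivered to observer node `i`. -/
def localInput (u : ∀ ι, Fin (S.mc ι) → ℝ) (i : Fin N) : Fin (S.ml i) → ℝ :=
  ∑ ι, S.R i ι *ᵥ u ι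

/-- Standing conventions: `∑ ι, B^ι u^ι` is of the form `B u`; for each observer node `i` it
splits as `B_i u_i + B_{-i} u_{-i}`; `C_i` has full row rank and `B_{-i}` full column rank. -/
structure Standing : Prop where
  input_eq : ∀ u : ∀ ι, Fin (S.mc ι) → ℝ, ∃ v : Fin m → ℝ, S.B *ᵥ v = S.inputTerm u
  split : ∀ (i : Fin N) (u : ∀ ι, Fin (S.mc ι) → ℝ), ∃ w : Fin (S.mm i) → ℝ,
    S.inputTerm u = S.Bl i *ᵥ S.localInput u i + S.Bm i *ᵥ w
  fullRowRank : ∀ i, (S.C i).rank = S.p i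
  fullColRank : ∀ i, (S.Bm i).rank = S.mm i

/-- The state feedback `u^ι = K^ι x` stabilizes the plant: every solution on `[0, ∞)` of
`x' = A x + ∑ ι, B^ι K^ι x` tends to zero. -/
def StateFeedbackStabilizes (K : ∀ ι, Matrix (Fin (S.mc ι)) (Fin n) ℝ) : Prop :=
  ∀ x : ℝ → Fin n → ℝ,
    (∀ t, 0 ≤ t → HasDerivWithinAt x (S.A *ᵥ x t + S.inputTerm (fun ι => K ι *ᵥ x t))
      (Set.Ici 0) t) →
    Tendsto (fun t => enorm2 (x t)) atTop (𝓝 0)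

end Network

/-- Design parameters of the `N` observer nodes. -/
structure Design {n m N Nc : ℕ} (S : Network n m N Nc) where
  /-- dimension of the locally reconstructible functional `T_{id}ᵀ x` -/
  δ : Fin N → ℕ
  /-- `T_{id}` -/
  Td : ∀ i, Matrix (Fin n) (Fin (δ i)) ℝ
  /-- `E_i` -/
  E : ∀ i, Matrix (Fin (δ i)) (Fin (δ i)) ℝ
  /-- `F_i` -/
  F : ∀ i, Matrix (Fin (δ i)) (Fin (S.p i)) ℝ
  /-- `G_i` -/
  G : ∀ i, Matrix (Fin (δ i)) (Fin (S.p i)) ℝ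
  /-- `T_{iu}` -/
  Tu : ∀ i, Matrix (Fin n) (Fin (n - δ i)) ℝ
  /-- step sizes `φ_i` -/
  φ : Fin N → ℝ
  /-- step sizes `φ_{is}` -/
  φs : Fin N → ℝ

namespace Design

variable {n m N Nc : ℕ} {S : Network n m N Nc} (D : Design S)

/-- The design rules for the observer nodes. -/
structure Admissible : Prop where
  maximal : ∀ i, IsMaximalDim S.A (S.Bm i) (S.C i) (D.δ i)
  observer : ∀ i, IsFunctionalObserver S.A (S.Bm i) (S.C i) (D.Td i) (D.E i) (D.F i) (D.G i)
  orthogonal : ∀ i, (D.Td i)ᵀ * D.Tu i = 0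
  orthonormal : ∀ i, (D.Tu i)ᵀ * D.Tu i = 1
  complement : ∀ i, D.Tu i * (D.Tu i)ᵀ = 1 - D.Td i * (D.Td i)ᵀ
  φ_pos : ∀ i, 0 < D.φ i
  φs_pos : ∀ i, 0 < D.φs i

/-- Collective strong detectability: the images of the `T_{id}` (the strongly detectable
subspaces of the observer nodes) together span the whole state space. -/
def CollectivelyStronglyDetectable : Prop :=
  (⨆ i, LinearMap.range (D.Td i).mulVecLin) = ⊤

/-- `Ē_i = T_{id} E_i T_{id}ᵀ + T_{iu} T_{iu}ᵀ A` -/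
def Ebar (i : Fin N) : Matrix (Fin n) (Fin n) ℝ :=
  D.Td i * D.E i * (D.Td i)ᵀ + D.Tu i * (D.Tu i)ᵀ * S.A

/-- `Ḡ_i = T_{id} G_i` -/
def Gbar (i : Fin N) : Matrix (Fin n) (Fin (S.p i)) ℝ :=
  D.Td i * D.G i

/-- `F̄_i = T_{id} F_i + T_{iu} T_{iu}ᵀ A Ḡ_i` -/
def Fbar (i : Fin N) : Matrix (Fin n) (Fin (S.p i)) ℝ :=
  D.Td i * D.F i + D.Tu i * (D.Tu i)ᵀ * S.A * D.Gbar i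

/-- `B̄_i = (I - Ḡ_i C_i) B_i` -/
def Bbar (i : Fin N) : Matrix (Fin n) (Fin (S.ml i)) ℝ :=
  (1 - D.Gbar i * S.C i) * S.Bl i

/-- The estimate `x̂_i = z_i + Ḡ_i y_i`, with `y_i = C_i x`. -/
def estimate (x : Fin n → ℝ) (z : Fin N → Fin n → ℝ) (i : Fin N) : Fin n → ℝ :=
  z i + D.Gbar i *ᵥ (S.C i *ᵥ x)

/-- `ε_{iu} = T_{iu}ᵀ ∑ j, a_{ij} (x̂_i - x̂_j)` -/
def consensusError (x : Fin n → ℝ) (z : Fin N → Fin n → ℝ) (i : Fin N) :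
    Fin (n - D.δ i) → ℝ :=
  (D.Tu i)ᵀ *ᵥ ∑ j, S.a i j • (D.estimate x z i - D.estimate x z j)

/-- The control inputs `u^ι = K^ι x̂_{σ(ι)}`: controller node `ι` uses the estimate of observer
node `σ ι`. -/
def feedback (K : ∀ ι, Matrix (Fin (S.mc ι)) (Fin n) ℝ) (σ : Fin Nc → Fin N)
    (x : Fin n → ℝ) (z : Fin N → Fin n → ℝ) (ι : Fin Nc) : Fin (S.mc ι) → ℝ :=
  K ι *ᵥ D.estimate x z (σ ι)

/-- `(x, z, γ, γs)` is a trajectory on `[0, ∞)` of the closed loop formed by the plant, the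
observer nodes with their adaptive gains, and the controllers `u^ι = K^ι x̂_{σ(ι)}`.  As the
right-hand side is discontinuous, trajectories are locally absolutely continuous and satisfy
the equations, with the direction map replaced by its set-valued version, at almost every
time. -/
structure IsTrajectory (K : ∀ ι, Matrix (Fin (S.mc ι)) (Fin n) ℝ) (σ : Fin Nc → Fin N)
    (x : ℝ → Fin n → ℝ) (z : Fin N → ℝ → Fin n → ℝ) (γ γs : Fin N → ℝ → ℝ) : Prop where
  x_ac : ∀ b, 0 ≤ b → AbsolutelyContinuousOnInterval x 0 b
  z_ac : ∀ i b, 0 ≤ b → AbsolutelyContinuousOnInterval (z i) 0 b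
  γ_ac : ∀ i b, 0 ≤ b → AbsolutelyContinuousOnInterval (γ i) 0 b
  γs_ac : ∀ i b, 0 ≤ b → AbsolutelyContinuousOnInterval (γs i) 0 b
  z_init : ∀ i, z i 0 = 0
  γ_init : ∀ i, 0 < γ i 0
  γs_init : ∀ i, 0 < γs i 0
  x_deriv : ∀ᵐ t : ℝ, 0 < t → HasDerivAt x
    (S.A *ᵥ x t + S.inputTerm (D.feedback K σ (x t) (fun j => z j t))) t
  z_deriv : ∀ i, ∀ᵐ t : ℝ, 0 < t →
    ∃ s ∈ direction (D.consensusError (x t) (fun j => z j t) i), HasDerivAt (z i)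
      (D.Ebar i *ᵥ z i t + D.Fbar i *ᵥ (S.C i *ᵥ x t)
        + D.Bbar i *ᵥ S.localInput (D.feedback K σ (x t) (fun j => z j t)) i
        - (γ i t • (D.Tu i *ᵥ D.consensusError (x t) (fun j => z j t) i)
          + γs i t • (D.Tu i *ᵥ s))) t
  γ_deriv : ∀ i, ∀ᵐ t : ℝ, 0 < t → HasDerivAt (γ i)
    (D.φ i * enorm2 (D.consensusError (x t) (fun j => z j t) i) ^ 2) t
  γs_deriv : ∀ i, ∀ᵐ t : ℝ, 0 < t → HasDerivAt (γs i)
    (D.φs i * enorm2 (D.consensusError (x t) (fun j => z j t) i)) t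

end Design

end DistObs

/-! In the coordinates ξ = (x, e), with e_i = x̂_i - x, the design equations remove x from the error
equations except through the inputs node i does not receive, and those enter only along Im T_{iu}.
Hence T_{id}ᵀ e_i obeys the autonomous equation with matrix E_i. Coupling acts only along Im T_{iu},
through ε_{iu} = T_{iu}ᵀ (L e)_i with L the graph Laplacian.

The storage function is V = ½ ∑ e_i ⬝ (L e)_i + x ⬝ P x + k ∑ (T_{id}ᵀ e_i) ⬝ Q_i (T_{id}ᵀ e_i) + ∑
(γ_i - k)² / (2 φ_i) + ∑ γ_{is}² / (2 φ_{is}), where P and Q_i are Lyapunov matrices for the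
state-feedback loop and the local errors. The adaptation laws cancel every term containing γ_i or
γ_{is}. What remains is a quadratic form f(ξ) minus k g(ξ), where g = ∑ ‖ε_{iu}‖² + ∑ ‖T_{id}ᵀ
e_i‖². If g(ξ) = 0, then connectivity and collective detectability force e = 0, so only the stable
plant is left and f(ξ) ≤ -‖x‖² < 0 for ξ ≠ 0. Finsler's lemma (`exists_sub_mul_le`, applied in
`exists_gain`) then provides k with V' ≤ -c‖ξ‖². The constant k occurs only in the analysis; the
observers need not know it. No separate stability of plant and observers is invoked: the feedback
interconnection is absorbed into f.

V is nonincreasing, so the gains are bounded. Convergence of ξ follows from a Barbalat argument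
(`tendsto_zero_of_dissipation`) with a positive definite energy W containing ½ ∑ e_i ⬝ (L e)_i. The
coupling terms lower W because the gains are positive, so W' ≤ C W without any bound on the
discontinuous right-hand side. -/

namespace DistObs

/-! ### Locally absolutely continuous functions and a Barbalat-type argument. -/

/-- Local absolute continuity on `[0, ∞)`. -/
def LocallyAC (f : ℝ → ℝ) : Prop := ∀ b, 0 ≤ b → AbsolutelyContinuousOnInterval f 0 b

namespace LocallyAC

variable {f g : ℝ → ℝ}

theorem add (hf : LocallyAC f) (hg : LocallyAC g) : LocallyAC fun t => f t + g t :=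
  fun b hb => (hf b hb).add (hg b hb)

theorem sub (hf : LocallyAC f) (hg : LocallyAC g) : LocallyAC fun t => f t - g t :=
  fun b hb => (hf b hb).sub (hg b hb)

theorem mul (hf : LocallyAC f) (hg : LocallyAC g) : LocallyAC fun t => f t * g t :=
  fun b hb => (hf b hb).mul (hg b hb)

theorem const_mul (c : ℝ) (hf : LocallyAC f) : LocallyAC fun t => c * f t :=
  fun b hb => (hf b hb).const_mul c

theorem neg (hf : LocallyAC f) : LocallyAC fun t => -f t :=
  fun b hb => (hf b hb).neg

theorem of_contDiff (hf : ContDiff ℝ 1 f) : LocallyAC f :=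
  fun _ _ => hf.contDiffOn.absolutelyContinuousOnInterval

theorem const (c : ℝ) : LocallyAC fun _ => c := of_contDiff contDiff_const

theorem pow_two (hf : LocallyAC f) : LocallyAC fun t => f t ^ 2 := by
  simpa only [sq] using hf.mul hf

theorem div_const (hf : LocallyAC f) (c : ℝ) : LocallyAC fun t => f t / c := by
  simpa only [div_eq_inv_mul] using hf.const_mul c⁻¹

theorem sum {ι : Type*} (s : Finset ι) {F : ι → ℝ → ℝ} (h : ∀ i ∈ s, LocallyAC (F i)) :
    LocallyAC fun t => ∑ i ∈ s, F i t := by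
  classical
  induction s using Finset.induction_on with
  | empty => simpa using const 0
  | insert a s ha ih =>
    simp only [Finset.sum_insert ha]
    exact (h a (by simp)).add (ih fun i hi => h i (by simp [hi]))

/-- A locally absolutely continuous function whose derivative is nonpositive almost everywhere
after time `T` is nonincreasing after time `T`. -/
theorem antitoneOn (hf : LocallyAC f) {T : ℝ} (hT : 0 ≤ T)
    (h : ∀ᵐ t : ℝ, T < t → ∃ d ≤ 0, HasDerivAt f d t) : AntitoneOn f (Set.Ici T) := by
  intro a ha b _ hab
  have ha' : T ≤ a := ha
  have hac : AbsolutelyContinuousOnInterval f a b := by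
    refine (hf b (by linarith)).mono ?_
    rw [Set.uIcc_of_le hab, Set.uIcc_of_le (by linarith)]
    exact Set.Icc_subset_Icc (by linarith) le_rfl
  have hint : ∫ t in a..b, deriv f t ≤ 0 := by
    have : 0 ≤ ∫ t in a..b, -deriv f t := by
      refine intervalIntegral.integral_nonneg_of_ae_restrict hab ?_
      rw [EventuallyLE, ae_restrict_iff' measurableSet_Icc]
      -- The derivative is controlled only for t > T, so the left endpoint, possibly T itself, is
      -- discarded as a null set.
      have hne : ∀ᵐ t : ℝ, t ≠ a := by simp [ae_iff, measure_singleton]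
      filter_upwards [h, hne] with t ht hta hmem
      obtain ⟨d, hd, hder⟩ := ht (lt_of_le_of_lt ha' (lt_of_le_of_ne hmem.1 (Ne.symm hta)))
      simpa [hder.deriv] using hd
    simpa using this
  rw [hac.integral_deriv_eq_sub] at hint
  linarith

theorem eq_zero_of_deriv (hf : LocallyAC f) (h0 : f 0 = 0)
    (h : ∀ᵐ t : ℝ, 0 < t → HasDerivAt f 0 t) {t : ℝ} (ht : 0 ≤ t) : f t = 0 := by
  have h1 := hf.antitoneOn le_rfl (by filter_upwards [h] with t ht h0 using ⟨0, le_rfl, ht h0⟩)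
    Set.self_mem_Ici (Set.mem_Ici.2 ht) ht
  have h2 := hf.neg.antitoneOn le_rfl
    (by filter_upwards [h] with t ht h0 using ⟨0, le_rfl, neg_zero (G := ℝ) ▸ (ht h0).neg⟩)
    Set.self_mem_Ici (Set.mem_Ici.2 ht) ht
  linarith

end LocallyAC

theorem tendsto_of_antitoneOn {f : ℝ → ℝ} (hf : AntitoneOn f (Set.Ici 0))
    (h0 : ∀ t, 0 ≤ t → 0 ≤ f t) : ∃ l, Tendsto f atTop (𝓝 l) := by
  have hanti : Antitone fun t => f (max t 0) := fun a b hab =>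
    hf (Set.mem_Ici.2 (le_max_right _ _)) (Set.mem_Ici.2 (le_max_right _ _)) (max_le_max_right 0 hab)
  refine ⟨_, (tendsto_atTop_ciInf hanti ⟨0, ?_⟩).congr' ?_⟩
  · rintro _ ⟨t, rfl⟩
    exact h0 _ (le_max_right _ _)
  · filter_upwards [eventually_ge_atTop 0] with t ht
    rw [max_eq_left ht]

/-- Barbalat-type argument: if `V ≥ 0` decreases at least at rate `W ≥ 0` and `W` grows at most
exponentially, then `W` tends to zero. -/
theorem tendsto_zero_of_dissipation {V W : ℝ → ℝ} {c C : ℝ} (hc : 0 < c) (hC : 0 ≤ C)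
    (hV : LocallyAC V) (hW : LocallyAC W)
    (hV0 : ∀ t, 0 ≤ t → 0 ≤ V t) (hW0 : ∀ t, 0 ≤ t → 0 ≤ W t)
    (hV' : ∀ᵐ t : ℝ, 0 < t → ∃ d ≤ -(c * W t), HasDerivAt V d t)
    (hW' : ∀ᵐ t : ℝ, 0 < t → ∃ d ≤ C * W t, HasDerivAt W d t) :
    Tendsto W atTop (𝓝 0) := by
  have hVanti : AntitoneOn V (Set.Ici 0) := hV.antitoneOn le_rfl <| by
    filter_upwards [hV'] with t ht h0
    obtain ⟨d, hd, h⟩ := ht h0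
    exact ⟨d, hd.trans (neg_nonpos.2 (mul_nonneg hc.le (hW0 t h0.le))), h⟩
  -- The growth of c W, at most c C W, is paid for by the decay of C V. Both V and this combination
  -- are monotone and bounded below, so W itself has a limit.
  have hUanti : AntitoneOn (fun t => c * W t + C * V t) (Set.Ici 0) :=
    ((hW.const_mul c).add (hV.const_mul C)).antitoneOn le_rfl <| by
      filter_upwards [hV', hW'] with t h1 h2 h0
      obtain ⟨d, hd, h⟩ := h1 h0
      obtain ⟨d', hd', h'⟩ := h2 h0
      refine ⟨c * d' + C * d, ?_, (h'.const_mul c).add (h.const_mul C)⟩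
      nlinarith [mul_le_mul_of_nonneg_left hd hC, mul_le_mul_of_nonneg_left hd' hc.le]
  obtain ⟨v, hv⟩ := tendsto_of_antitoneOn hVanti hV0
  obtain ⟨u, hu⟩ := tendsto_of_antitoneOn hUanti fun t ht =>
    add_nonneg (mul_nonneg hc.le (hW0 t ht)) (mul_nonneg hC (hV0 t ht))
  have hWl : Tendsto W atTop (𝓝 (c⁻¹ * (u - C * v))) := by
    refine ((hu.sub (hv.const_mul C)).const_mul c⁻¹).congr fun t => ?_
    field_simp
    ring
  set l := c⁻¹ * (u - C * v) with hl
  have hl0 : 0 ≤ l := ge_of_tendsto hWl (by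
    filter_upwards [eventually_ge_atTop 0] with t ht using hW0 t ht)
  rcases hl0.eq_or_lt with h | hpos
  · rwa [← h] at hWl
  exfalso
  -- A positive limit l would make V decrease at rate at least c l / 2 from some time on, and V
  -- would become negative.
  obtain ⟨T, hT⟩ := eventually_atTop.1 (hWl.eventually (lt_mem_nhds (half_lt_self hpos)))
  set T' := max T 0
  have hanti : AntitoneOn (fun t => V t + c * (l / 2) * t) (Set.Ici T') := by
    refine (hV.add ((LocallyAC.of_contDiff contDiff_id).const_mul (c * (l / 2)))).antitoneOn
      (le_max_right _ _) ?_
    filter_upwards [hV'] with t h1 ht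
    obtain ⟨d, hd, h⟩ := h1 ((le_max_right _ _).trans_lt ht)
    refine ⟨d + c * (l / 2) * 1, ?_, h.add ((hasDerivAt_id t).const_mul _)⟩
    have := hT t ((le_max_left _ _).trans ht.le)
    nlinarith [mul_lt_mul_of_pos_left this hc]
  have hb : ∀ t, T' ≤ t → c * (l / 2) * t ≤ V T' + c * (l / 2) * T' := fun t ht => by
    have h1 : V t + c * (l / 2) * t ≤ V T' + c * (l / 2) * T' :=
      hanti Set.self_mem_Ici (Set.mem_Ici.2 ht) ht
    linarith [hV0 t ((le_max_right _ _).trans ht)]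
  have hgrow : Tendsto (fun t => c * (l / 2) * t) atTop atTop :=
    tendsto_id.const_mul_atTop (by positivity)
  obtain ⟨t, ht1, ht2⟩ :=
    ((hgrow.eventually_gt_atTop (V T' + c * (l / 2) * T')).and (eventually_ge_atTop T')).exists
  exact absurd (hb t ht2) (not_le.2 ht1)

/-! ### Homogeneous maps, quadratic functions and Finsler's lemma. -/

/-- Continuous and homogeneous of degree one. -/
structure IsHomogeneousMap {H F : Type*} [TopologicalSpace H] [SMul ℝ H] [TopologicalSpace F]
    [SMul ℝ F] (u : H → F) : Prop where
  continuous : Continuous u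
  map_smul : ∀ (r : ℝ) v, u (r • v) = r • u v

/-- Continuous and homogeneous of degree two. -/
structure IsQuadratic {H : Type*} [TopologicalSpace H] [SMul ℝ H] (f : H → ℝ) : Prop where
  continuous : Continuous f
  map_smul : ∀ (r : ℝ) v, f (r • v) = r ^ 2 * f v

namespace IsHomogeneousMap

variable {H : Type*} [TopologicalSpace H] [SMul ℝ H] {k l : ℕ} {u v : H → Fin k → ℝ}

theorem add (hu : IsHomogeneousMap u) (hv : IsHomogeneousMap v) :
    IsHomogeneousMap fun w => u w + v w :=
  ⟨hu.continuous.add hv.continuous, fun r w => by rw [hu.map_smul, hv.map_smul, smul_add]⟩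

theorem sub (hu : IsHomogeneousMap u) (hv : IsHomogeneousMap v) :
    IsHomogeneousMap fun w => u w - v w :=
  ⟨hu.continuous.sub hv.continuous, fun r w => by rw [hu.map_smul, hv.map_smul, smul_sub]⟩

theorem const_smul (c : ℝ) (hu : IsHomogeneousMap u) : IsHomogeneousMap fun w => c • u w :=
  ⟨hu.continuous.const_smul c, fun r w => by rw [hu.map_smul, smul_comm]⟩

theorem sum {ι : Type*} {s : Finset ι} {u : ι → H → Fin k → ℝ}
    (hu : ∀ i, IsHomogeneousMap (u i)) : IsHomogeneousMap fun w => ∑ i ∈ s, u i w :=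
  ⟨continuous_finsetSum _ fun i _ => (hu i).continuous, fun r w => by
    rw [Finset.smul_sum]
    exact Finset.sum_congr rfl fun i _ => (hu i).map_smul r w⟩

theorem mulVec (M : Matrix (Fin l) (Fin k) ℝ) (hu : IsHomogeneousMap u) :
    IsHomogeneousMap fun w => M *ᵥ u w :=
  ⟨continuous_const.matrix_mulVec hu.continuous, fun r w => by
    rw [hu.map_smul, Matrix.mulVec_smul]⟩

theorem dotProduct (hu : IsHomogeneousMap u) (hv : IsHomogeneousMap v) :
    IsQuadratic fun w => u w ⬝ᵥ v w :=
  ⟨hu.continuous.dotProduct hv.continuous, fun r w => by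
    rw [hu.map_smul, hv.map_smul, smul_dotProduct, dotProduct_smul, smul_eq_mul, smul_eq_mul]
    ring⟩

end IsHomogeneousMap

namespace IsQuadratic

variable {H : Type*} [TopologicalSpace H] [SMul ℝ H] {f g : H → ℝ}

theorem add (hf : IsQuadratic f) (hg : IsQuadratic g) : IsQuadratic fun w => f w + g w :=
  ⟨hf.continuous.add hg.continuous, fun r w => by rw [hf.map_smul, hg.map_smul, mul_add]⟩

theorem const_mul (c : ℝ) (hf : IsQuadratic f) : IsQuadratic fun w => c * f w :=
  ⟨hf.continuous.const_mul c, fun r w => by rw [hf.map_smul]; ring⟩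

theorem sum {ι : Type*} {s : Finset ι} {f : ι → H → ℝ} (hf : ∀ i, IsQuadratic (f i)) :
    IsQuadratic fun w => ∑ i ∈ s, f i w :=
  ⟨continuous_finsetSum _ fun i _ => (hf i).continuous, fun r w => by
    rw [Finset.mul_sum]
    exact Finset.sum_congr rfl fun i _ => (hf i).map_smul r w⟩

end IsQuadratic

theorem IsQuadratic.map_zero {H : Type*} [NormedAddCommGroup H] [NormedSpace ℝ H] {f : H → ℝ}
    (hf : IsQuadratic f) : f 0 = 0 := by
  have h := hf.map_smul 0 0
  rwa [zero_smul, zero_pow two_ne_zero, zero_mul] at h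

/-- Finsler's lemma for continuous functions that are homogeneous of degree two. -/
theorem exists_sub_mul_le {H : Type*} [NormedAddCommGroup H] [NormedSpace ℝ H]
    [FiniteDimensional ℝ H] {f g : H → ℝ} (hf : IsQuadratic f) (hg : IsQuadratic g)
    (hg0 : ∀ v, 0 ≤ g v) (h : ∀ v, v ≠ 0 → g v = 0 → f v < 0) :
    ∃ k > 0, ∃ c > 0, ∀ v, f v - k * g v ≤ -(c * ‖v‖ ^ 2) := by
  have : ProperSpace H := FiniteDimensional.proper ℝ H
  have hcpt : IsCompact (Metric.sphere (0 : H) 1) := isCompact_sphere 0 1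
  have hne : ∀ v ∈ Metric.sphere (0 : H) 1, v ≠ 0 := fun v hv h0 => by simp [h0] at hv
  -- The open sets {f < k g} increase with k because g ≥ 0, and they cover the unit sphere; by
  -- compactness one of them suffices.
  obtain ⟨k, hk⟩ : ∃ k : ℕ, Metric.sphere (0 : H) 1 ⊆ {v | f v < k * g v} := by
    refine hcpt.elim_directed_cover (fun k : ℕ => {v | f v < k * g v})
      (fun k => isOpen_lt hf.continuous (continuous_const.mul hg.continuous)) (fun v hv => ?_)
      (directed_of_isDirected_le fun a b hab v hv => ?_)
    · rw [Set.mem_iUnion]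
      rcases (hg0 v).eq_or_lt with h0 | h0
      · exact ⟨0, by simpa using h v (hne v hv) h0.symm⟩
      · obtain ⟨k, hk⟩ := exists_nat_gt (f v / g v)
        exact ⟨k, (div_lt_iff₀ h0).1 hk⟩
    · exact lt_of_lt_of_le (Set.mem_ofPred.1 hv)
        (mul_le_mul_of_nonneg_right (by exact_mod_cast hab) (hg0 v))
  -- Passing from k to k + 1 keeps the strict inequality and makes the constant positive even when k
  -- = 0.
  have hcont : ContinuousOn (fun v => (k + 1 : ℝ) * g v - f v) (Metric.sphere (0 : H) 1) := by
    exact ((hg.continuous.const_mul _).sub hf.continuous).continuousOn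
  obtain ⟨c, hc, hc'⟩ : ∃ c > 0, ∀ v ∈ Metric.sphere (0 : H) 1, c ≤ (k + 1 : ℝ) * g v - f v := by
    rcases (Metric.sphere (0 : H) 1).eq_empty_or_nonempty with he | hn
    · exact ⟨1, one_pos, by simp [he]⟩
    · obtain ⟨w, hw, hmin⟩ := hcpt.exists_isMinOn hn hcont
      have hw' : f w < k * g w := hk hw
      exact ⟨(k + 1 : ℝ) * g w - f w, by linarith [hg0 w], fun v hv => hmin hv⟩
  refine ⟨k + 1, by positivity, c, hc, fun v => ?_⟩
  by_cases hv : v = 0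
  · rw [hv, hf.map_zero, hg.map_zero, norm_zero]
    norm_num
  · have hnv : ‖v‖ ≠ 0 := norm_ne_zero_iff.2 hv
    have h1 := hc' (‖v‖⁻¹ • v) (by simp [norm_smul, hnv])
    rw [hf.map_smul, hg.map_smul] at h1
    have h2 := mul_le_mul_of_nonneg_left h1 (sq_nonneg ‖v‖)
    have h3 : ‖v‖ ^ 2 * ((k + 1 : ℝ) * (‖v‖⁻¹ ^ 2 * g v) - ‖v‖⁻¹ ^ 2 * f v)
        = (k + 1 : ℝ) * g v - f v := by
      field_simp
    linarith

/-- Finsler's lemma with g positive definite: its condition on the zero set of g is vacuous. It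
serves to compare quadratic functions with each other. -/
theorem exists_le_mul {H : Type*} [NormedAddCommGroup H] [NormedSpace ℝ H]
    [FiniteDimensional ℝ H] {f g : H → ℝ} (hf : IsQuadratic f) (hg : IsQuadratic g)
    (hg0 : ∀ v, v ≠ 0 → 0 < g v) :
    ∃ C > 0, ∀ v, f v ≤ C * g v := by
  obtain ⟨k, hk, c, hc, h⟩ := exists_sub_mul_le hf hg
    (fun v => by
      by_cases hv : v = 0
      · rw [hv, hg.map_zero]
      · exact (hg0 v hv).le)
    (fun v hv h0 => absurd h0 (hg0 v hv).ne')
  exact ⟨k, hk, fun v => by nlinarith [h v, sq_nonneg ‖v‖]⟩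


/-! ### Hurwitz matrices and Lyapunov functions. -/

theorem mem_spectrum_iff_exists_mulVec {k : ℕ} {M : Matrix (Fin k) (Fin k) ℂ} {μ : ℂ} :
    μ ∈ spectrum ℂ M ↔ ∃ v ≠ 0, M *ᵥ v = μ • v := by
  rw [spectrum.mem_iff, Matrix.isUnit_iff_isUnit_det, isUnit_iff_ne_zero, not_not,
    ← Matrix.exists_mulVec_eq_zero_iff]
  refine exists_congr fun v => and_congr_right fun _ => ?_
  rw [Matrix.sub_mulVec, Algebra.algebraMap_eq_smul_one, Matrix.smul_mulVec, Matrix.one_mulVec,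
    sub_eq_zero, eq_comm]

section

attribute [local instance] Matrix.linftyOpNormedRing Matrix.linftyOpNormedAlgebra

/-- By Gelfand's formula ‖M ^ N‖ is eventually at most r ^ N for some r < 1, and the operator norm
for the sup norm dominates each entry. -/
theorem tendsto_pow_entry_of_spectrum_lt_one {k : ℕ} (M : Matrix (Fin k) (Fin k) ℂ)
    (h : ∀ μ ∈ spectrum ℂ M, ‖μ‖ < 1) (i j : Fin k) :
    Tendsto (fun N : ℕ => (M ^ N) i j) atTop (𝓝 0) := by
  have : Nonempty (Fin k) := ⟨i⟩
  have : Nontrivial (Matrix (Fin k) (Fin k) ℂ) := inferInstance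
  have : CompleteSpace (Matrix (Fin k) (Fin k) ℂ) := FiniteDimensional.complete ℂ _
  have hr : spectralRadius ℂ M < (1 : NNReal) := spectrum.spectralRadius_lt_of_forall_lt M
    fun z hz => by exact_mod_cast h z hz
  obtain ⟨r, hr1, hr2⟩ := ENNReal.lt_iff_exists_nnreal_btwn.1 hr
  have hg := (spectrum.pow_nnnorm_pow_one_div_tendsto_nhds_spectralRadius M).eventually
    (gt_mem_nhds hr1)
  have hle : ∀ᶠ N : ℕ in atTop, ‖(M ^ N) i j‖ ≤ (r : ℝ) ^ N := by
    filter_upwards [hg, eventually_gt_atTop 0] with N hN hN0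
    have h1 : (‖M ^ N‖₊ : ENNReal) ≤ (r : ENNReal) ^ N := by
      have h2 := ENNReal.rpow_le_rpow hN.le (Nat.cast_nonneg (α := ℝ) N)
      rwa [← ENNReal.rpow_mul, one_div, inv_mul_cancel₀ (by positivity), ENNReal.rpow_one,
        ENNReal.rpow_natCast] at h2
    have h3 : ‖M ^ N‖ ≤ (r : ℝ) ^ N := by exact_mod_cast h1
    refine le_trans ?_ h3
    rw [Matrix.linfty_opNorm_def, ← coe_nnnorm]
    refine NNReal.coe_le_coe.2 (le_trans ?_ (Finset.le_sup (Finset.mem_univ i)))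
    exact Finset.single_le_sum (f := fun j => ‖(M ^ N) i j‖₊) (fun _ _ => zero_le)
      (Finset.mem_univ j)
  refine squeeze_zero_norm' hle (tendsto_pow_atTop_nhds_zero_of_lt_one r.2 ?_)
  exact_mod_cast hr2

end

/-- A real matrix without eigenvalues in the closed right half plane has a quadratic Lyapunov
function. -/
theorem IsHurwitz.exists_lyapunov {k : ℕ} {E : Matrix (Fin k) (Fin k) ℝ} (hE : IsHurwitz E) :
    ∃ P : Matrix (Fin k) (Fin k) ℝ, Pᵀ = P ∧ (∀ v, 0 ≤ v ⬝ᵥ P *ᵥ v) ∧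
      ∀ v, 2 * (v ⬝ᵥ P *ᵥ (E *ᵥ v)) ≤ -(v ⬝ᵥ v) := by
  set φ : Matrix (Fin k) (Fin k) ℝ →+* Matrix (Fin k) (Fin k) ℂ := (algebraMap ℝ ℂ).mapMatrix
    with hφ
  have hdetC : IsUnit (1 - φ E) := by
    by_contra hcon
    have h1 : (1 : ℂ) ∈ spectrum ℂ (φ E) := by
      rw [spectrum.mem_iff]
      simpa using hcon
    have := hE 1 h1
    norm_num at this
  have hdet : IsUnit (1 - E).det := by
    rw [Matrix.isUnit_iff_isUnit_det, isUnit_iff_ne_zero, ← map_one φ, ← map_sub, hφ,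
      ← RingHom.map_det] at hdetC
    exact isUnit_iff_ne_zero.2 fun h => hdetC (by rw [h, map_zero])
  -- The Cayley transform carries the open left half plane into the open unit disc. It replaces the
  -- integral of matrix exponentials in the usual construction by powers of M.
  set M := (1 + E) * (1 - E)⁻¹ with hM
  have hM' : M * (1 - E) = 1 + E := by
    rw [hM, Matrix.mul_assoc, Matrix.nonsing_inv_mul _ hdet, Matrix.mul_one]
  have hinv : (1 - E) * (1 - E)⁻¹ = 1 := Matrix.mul_nonsing_inv _ hdet
  have hspec : ∀ μ ∈ spectrum ℂ (φ M), ‖μ‖ < 1 := by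
    intro μ hμ
    obtain ⟨v, hv, hvμ⟩ := mem_spectrum_iff_exists_mulVec.1 hμ
    set w := φ (1 - E)⁻¹ *ᵥ v with hw
    have hvw : v = w - φ E *ᵥ w := by
      have : φ (1 - E) *ᵥ w = v := by
        rw [hw, Matrix.mulVec_mulVec, ← map_mul, hinv, map_one, Matrix.one_mulVec]
      rw [← this, map_sub, map_one, Matrix.sub_mulVec, Matrix.one_mulVec]
    have hw0 : w ≠ 0 := by
      rintro h
      rw [h] at hvw
      exact hv (by simpa using hvw)
    have heq : w + φ E *ᵥ w = μ • (w - φ E *ᵥ w) := by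
      rw [← hvw, ← hvμ, hM, map_mul, ← Matrix.mulVec_mulVec, ← hw, map_add, map_one,
        Matrix.add_mulVec, Matrix.one_mulVec]
    have heq2 : (1 + μ) • (φ E *ᵥ w) = (μ - 1) • w := by
      rw [smul_sub] at heq
      have := sub_eq_zero.2 heq
      rw [← sub_eq_zero, ← this]
      module
    have hμ1 : 1 + μ ≠ 0 := by
      intro h
      rw [h, zero_smul] at heq2
      have : μ - 1 = 0 := (smul_eq_zero.1 heq2.symm).resolve_right hw0
      have h2 : (2 : ℂ) = 0 := by linear_combination h - this
      norm_num at h2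
    -- This is the inverse Cayley transform of μ. Its real part is (|μ|² - 1) / |1 + μ|², which is
    -- negative exactly when |μ| < 1.
    have hmem : (μ - 1) / (1 + μ) ∈ spectrum ℂ (φ E) := by
      refine mem_spectrum_iff_exists_mulVec.2 ⟨w, hw0, ?_⟩
      rw [div_eq_inv_mul, mul_smul, ← heq2, smul_smul, inv_mul_cancel₀ hμ1, one_smul]
    have hre := hE _ hmem
    rw [Complex.div_re, ← add_div] at hre
    have hpos : 0 < Complex.normSq (1 + μ) := Complex.normSq_pos.2 hμ1
    rw [div_lt_iff₀ hpos, zero_mul] at hre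
    have hsq : μ.re * μ.re + μ.im * μ.im < 1 := by
      simp only [Complex.sub_re, Complex.one_re, Complex.add_re, Complex.sub_im, Complex.one_im,
        Complex.add_im] at hre
      nlinarith
    rw [← Complex.normSq_apply, Complex.normSq_eq_norm_sq] at hsq
    nlinarith [norm_nonneg μ]
  have hentry : ∀ i j, Tendsto (fun N : ℕ => (M ^ N) i j) atTop (𝓝 0) := fun i j => by
    have h1 := tendsto_pow_entry_of_spectrum_lt_one (φ M) hspec i j
    have h2 := (Complex.continuous_re.tendsto _).comp h1
    refine h2.congr fun N => ?_
    have h3 : φ M ^ N = φ (M ^ N) := (map_pow φ M N).symm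
    rw [Function.comp_apply, h3]
    exact Complex.ofReal_re _
  have hsq : Tendsto (fun N : ℕ => ∑ i, ∑ j, ((M ^ N) i j) ^ 2) atTop (𝓝 0) := by
    have := tendsto_finsetSum (Finset.univ : Finset (Fin k)) fun i _ =>
      tendsto_finsetSum (Finset.univ : Finset (Fin k)) fun j _ => (hentry i j).pow 2
    simpa using this
  obtain ⟨N, hN⟩ := (hsq.eventually (gt_mem_nhds (show (0 : ℝ) < 1 / 2 by norm_num))).exists
  have hcontr : ∀ v, (M ^ N *ᵥ v) ⬝ᵥ (M ^ N *ᵥ v) ≤ 1 / 2 * (v ⬝ᵥ v) := fun v => by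
    have h1 : (M ^ N *ᵥ v) ⬝ᵥ (M ^ N *ᵥ v) ≤ (∑ i, ∑ j, ((M ^ N) i j) ^ 2) * (v ⬝ᵥ v) := by
      rw [Finset.sum_mul]
      refine Finset.sum_le_sum fun i _ => ?_
      rw [← sq]
      simpa only [Matrix.mulVec, dotProduct, sq] using
        Finset.sum_mul_sq_le_sq_mul_sq Finset.univ ((M ^ N) i) v
    exact h1.trans (mul_le_mul_of_nonneg_right hN.le (dotProduct_self_star_nonneg v))
  -- A finite sum suffices: Mᵀ Q M - Q telescopes to (M ^ N)ᵀ M ^ N - 1, and `hcontr` makes this at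
  -- most -1/2.
  set Q : Matrix (Fin k) (Fin k) ℝ := ∑ l ∈ Finset.range N, (M ^ l)ᵀ * M ^ l with hQ
  have hQT : Qᵀ = Q := by
    rw [hQ, Matrix.transpose_sum]
    simp [Matrix.transpose_mul]
  have hQv : ∀ v w, v ⬝ᵥ Q *ᵥ w = ∑ l ∈ Finset.range N, (M ^ l *ᵥ v) ⬝ᵥ (M ^ l *ᵥ w) :=
    fun v w => by
      rw [hQ, Matrix.sum_mulVec, dotProduct_sum]
      refine Finset.sum_congr rfl fun l _ => ?_
      rw [← Matrix.mulVec_mulVec, Matrix.dotProduct_mulVec, Matrix.vecMul_transpose]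
  have hQsymm : ∀ v w, v ⬝ᵥ Q *ᵥ w = w ⬝ᵥ Q *ᵥ v := fun v w => by
    simp only [hQv, dotProduct_comm]
  have htel : ∀ v, (M *ᵥ v) ⬝ᵥ Q *ᵥ (M *ᵥ v) - v ⬝ᵥ Q *ᵥ v =
      (M ^ N *ᵥ v) ⬝ᵥ (M ^ N *ᵥ v) - v ⬝ᵥ v := fun v => by
    have := Finset.sum_range_sub (fun l => (M ^ l *ᵥ v) ⬝ᵥ (M ^ l *ᵥ v)) N
    simp only [pow_zero, Matrix.one_mulVec] at this
    rw [← this, hQv, hQv, Finset.sum_sub_distrib]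
    simp only [Matrix.mulVec_mulVec, pow_succ]
  have hdiss : ∀ w, 4 * (w ⬝ᵥ Q *ᵥ (E *ᵥ w)) ≤
      -(1 / 2 * (((1 - E) *ᵥ w) ⬝ᵥ ((1 - E) *ᵥ w))) := fun w => by
    have h1 := htel ((1 - E) *ᵥ w)
    rw [Matrix.mulVec_mulVec, hM'] at h1
    have h2 := hcontr ((1 - E) *ᵥ w)
    -- For v = (1 - E) w one has M v = (1 + E) w. Polarization then turns the discrete-time decrease
    -- into the continuous-time one.
    have h3 : ((1 + E) *ᵥ w) ⬝ᵥ Q *ᵥ ((1 + E) *ᵥ w) -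
        ((1 - E) *ᵥ w) ⬝ᵥ Q *ᵥ ((1 - E) *ᵥ w) = 4 * (w ⬝ᵥ Q *ᵥ (E *ᵥ w)) := by
      simp only [Matrix.add_mulVec, Matrix.sub_mulVec, Matrix.one_mulVec, Matrix.mulVec_add,
        Matrix.mulVec_sub, dotProduct_add, add_dotProduct, dotProduct_sub, sub_dotProduct,
        hQsymm (E *ᵥ w) w]
      ring
    linarith
  obtain ⟨C, hC, hCle⟩ : ∃ C > 0, ∀ w : Fin k → ℝ,
      w ⬝ᵥ w ≤ C * (((1 - E) *ᵥ w) ⬝ᵥ ((1 - E) *ᵥ w)) := by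
    have hid : IsHomogeneousMap fun w : Fin k → ℝ => w := ⟨continuous_id, fun _ _ => rfl⟩
    refine exists_le_mul (hid.dotProduct hid) ((hid.mulVec _).dotProduct (hid.mulVec _))
      fun v hv => ?_
    refine lt_of_le_of_ne (dotProduct_self_star_nonneg _) fun h => hv ?_
    have h0 : (1 - E) *ᵥ v = 0 := dotProduct_self_eq_zero.1 h.symm
    exact Matrix.eq_zero_of_mulVec_eq_zero hdet.ne_zero h0
  -- With this factor the decrease is at least C ‖(1 - E) w‖², which dominates ‖w‖² by the choice of
  -- C.
  refine ⟨(4 * C) • Q, by rw [Matrix.transpose_smul, hQT], fun v => ?_, fun v => ?_⟩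
  · rw [Matrix.smul_mulVec, dotProduct_smul, hQv]
    exact mul_nonneg (by positivity) (Finset.sum_nonneg fun l _ => dotProduct_self_star_nonneg _)
  · rw [Matrix.smul_mulVec, dotProduct_smul, smul_eq_mul]
    nlinarith [mul_le_mul_of_nonneg_left (hdiss v) hC.le, hCle v]

/-- If all solutions of `x' = M x` on `[0, ∞)` tend to zero, then `M` is Hurwitz. -/
theorem isHurwitz_of_forall_tendsto {k : ℕ} {M : Matrix (Fin k) (Fin k) ℝ}
    (h : ∀ x : ℝ → Fin k → ℝ, (∀ t, HasDerivAt x (M *ᵥ x t) t) →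
      ∀ i, Tendsto (fun t => x t i) atTop (𝓝 0)) : IsHurwitz M := by
  intro μ hμ
  obtain ⟨v, hv, hvμ⟩ := mem_spectrum_iff_exists_mulVec.1 hμ
  by_contra hneg
  rw [not_lt] at hneg
  -- Re (c exp(μ t) v) is a real solution for every complex c. The values c = 1 and c = -i give the
  -- real and imaginary parts of exp(μ t) v, whose modulus cannot decay when Re μ ≥ 0.
  have key : ∀ c : ℂ, ∀ i,
      Tendsto (fun t : ℝ => (c * (Complex.exp (μ * t) * v i)).re) atTop (𝓝 0) := by
    intro c
    refine h (fun t i => (c * (Complex.exp (μ * t) * v i)).re) fun t => ?_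
    rw [hasDerivAt_pi]
    intro i
    have h1 : HasDerivAt (fun s : ℝ => Complex.exp (μ * s)) (Complex.exp (μ * t) * (μ * 1)) t :=
      (((hasDerivAt_id (t : ℂ)).const_mul μ).cexp).comp_ofReal
    have h2 := ((h1.mul_const (v i)).const_mul c)
    have h3 := Complex.reCLM.hasFDerivAt.comp_hasDerivAt t h2
    refine h3.congr_deriv ?_
    have h4 : μ * v i = ∑ j, (M i j : ℂ) * v j := (congrFun hvμ i).symm
    calc Complex.reCLM (c * (Complex.exp (μ * t) * (μ * 1) * v i))
        = (c * Complex.exp (μ * t) * (μ * v i)).re := by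
          rw [Complex.reCLM_apply]; congr 1; ring
      _ = (∑ j, (M i j : ℂ) * (c * (Complex.exp (μ * t) * v j))).re := by
          rw [h4, Finset.mul_sum]; congr 1; exact Finset.sum_congr rfl fun j _ => by ring
      _ = _ := by
          rw [Complex.re_sum]
          simp only [Complex.re_ofReal_mul, Matrix.mulVec, dotProduct]
  obtain ⟨i, hi⟩ : ∃ i, v i ≠ 0 := by
    by_contra hcon
    push Not at hcon
    exact hv (funext hcon)
  have h1 := key 1 i
  have h2 := key (-Complex.I) i
  have h3 : Tendsto (fun t : ℝ => ‖Complex.exp (μ * t) * v i‖ ^ 2) atTop (𝓝 0) := by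
    have := (h1.pow 2).add (h2.pow 2)
    norm_num only at this
    refine this.congr fun t => ?_
    rw [← Complex.normSq_eq_norm_sq, Complex.normSq_apply]
    simp
    ring
  have h4 : ‖v i‖ ^ 2 ≤ 0 := ge_of_tendsto h3 <| by
    filter_upwards [eventually_ge_atTop 0] with t ht
    rw [norm_mul, Complex.norm_exp]
    have : 1 ≤ Real.exp (μ * t).re := by
      rw [Complex.re_mul_ofReal]
      exact Real.one_le_exp (mul_nonneg hneg ht)
    exact pow_le_pow_left₀ (norm_nonneg _) (le_mul_of_one_le_left (norm_nonneg _) this) 2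
  have := pow_pos (norm_pos_iff.2 hi) 2
  linarith


/-! ### Euclidean norms, the direction map and calculus along vector-valued curves. -/

theorem enorm2_sq {k : ℕ} (v : Fin k → ℝ) : enorm2 v ^ 2 = v ⬝ᵥ v := by
  rw [enorm2, EuclideanSpace.norm_sq_eq]
  simp [dotProduct, sq]

theorem dotProduct_self_nonneg_real {k : ℕ} (v : Fin k → ℝ) : 0 ≤ v ⬝ᵥ v := by
  rw [← enorm2_sq]
  positivity

theorem enorm2_zero {k : ℕ} : enorm2 (0 : Fin k → ℝ) = 0 := by simp [enorm2]

theorem enorm2_nonneg {k : ℕ} (v : Fin k → ℝ) : 0 ≤ enorm2 v := norm_nonneg _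

theorem tendsto_enorm2_of_sq {k : ℕ} {v : ℝ → Fin k → ℝ}
    (h : Tendsto (fun t => v t ⬝ᵥ v t) atTop (𝓝 0)) :
    Tendsto (fun t => enorm2 (v t)) atTop (𝓝 0) := by
  have h1 := (Real.continuous_sqrt.tendsto 0).comp h
  rw [Real.sqrt_zero] at h1
  refine h1.congr fun t => ?_
  rw [Function.comp_apply, ← enorm2_sq, Real.sqrt_sq (enorm2_nonneg _)]

/-- At w = 0 both sides vanish whatever s is. The choice made by Filippov's convention is therefore
invisible to the Lyapunov computation. -/
theorem dotProduct_eq_enorm2_of_mem_direction {k : ℕ} {w s : Fin k → ℝ} (h : s ∈ direction w) :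
    w ⬝ᵥ s = enorm2 w := by
  by_cases hw : w = 0
  · rw [hw, zero_dotProduct, enorm2_zero]
  · rw [h.1 hw, dotProduct_smul, ← enorm2_sq, smul_eq_mul]
    by_cases h0 : enorm2 w = 0
    · simp [h0]
    · field_simp

/-- Componentwise local absolute continuity on `[0, ∞)`. -/
def VecLocallyAC {k : ℕ} (u : ℝ → Fin k → ℝ) : Prop := ∀ i, LocallyAC fun t => u t i

namespace VecLocallyAC

variable {k l : ℕ} {u v : ℝ → Fin k → ℝ}

theorem of_absolutelyContinuous (h : ∀ b, 0 ≤ b → AbsolutelyContinuousOnInterval u 0 b) :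
    VecLocallyAC u := fun i b hb => by
  refine squeeze_zero (fun _ => Finset.sum_nonneg fun _ _ => dist_nonneg) (fun E => ?_) (h b hb)
  exact Finset.sum_le_sum fun j _ => dist_le_pi_dist _ _ i

theorem add (hu : VecLocallyAC u) (hv : VecLocallyAC v) : VecLocallyAC fun t => u t + v t :=
  fun i => (hu i).add (hv i)

theorem sub (hu : VecLocallyAC u) (hv : VecLocallyAC v) : VecLocallyAC fun t => u t - v t :=
  fun i => (hu i).sub (hv i)

theorem const_smul (c : ℝ) (hu : VecLocallyAC u) : VecLocallyAC fun t => c • u t :=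
  fun i => (hu i).const_mul c

theorem sum {ι : Type*} {s : Finset ι} {u : ι → ℝ → Fin k → ℝ} (hu : ∀ i, VecLocallyAC (u i)) :
    VecLocallyAC fun t => ∑ i ∈ s, u i t := fun j => by
  simpa only [Finset.sum_apply] using LocallyAC.sum s fun i _ => hu i j

theorem mulVec (M : Matrix (Fin l) (Fin k) ℝ) (hu : VecLocallyAC u) :
    VecLocallyAC fun t => M *ᵥ u t := fun i => by
  simp only [Matrix.mulVec_eq_sum, Finset.sum_apply, Pi.smul_apply, MulOpposite.smul_eq_mul_unop,
    MulOpposite.unop_op, Matrix.transpose_apply]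
  exact LocallyAC.sum Finset.univ fun j _ => (hu j).const_mul (M i j)

theorem dotProduct (hu : VecLocallyAC u) (hv : VecLocallyAC v) :
    LocallyAC fun t => u t ⬝ᵥ v t :=
  LocallyAC.sum Finset.univ fun j _ => (hu j).mul (hv j)

end VecLocallyAC

section Derivatives

variable {k l : ℕ} {u v : ℝ → Fin k → ℝ} {u' v' : Fin k → ℝ} {t : ℝ}

theorem hasDerivAt_mulVec (M : Matrix (Fin l) (Fin k) ℝ) (hu : HasDerivAt u u' t) :
    HasDerivAt (fun t => M *ᵥ u t) (M *ᵥ u') t :=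
  hasDerivAt_pi.2 fun i => by
    have := HasDerivAt.fun_sum (u := Finset.univ) fun j _ =>
      (hasDerivAt_pi.1 hu j).const_mul (M i j)
    exact this

theorem hasDerivAt_dotProduct (hu : HasDerivAt u u' t) (hv : HasDerivAt v v' t) :
    HasDerivAt (fun t => u t ⬝ᵥ v t) (u' ⬝ᵥ v t + u t ⬝ᵥ v') t := by
  have := HasDerivAt.fun_sum (u := Finset.univ) fun j _ =>
    (hasDerivAt_pi.1 hu j).mul (hasDerivAt_pi.1 hv j)
  rw [Finset.sum_add_distrib] at this
  exact this

theorem dotProduct_mulVec_symm {P : Matrix (Fin k) (Fin k) ℝ} (hP : Pᵀ = P) (v w : Fin k → ℝ) :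
    v ⬝ᵥ P *ᵥ w = w ⬝ᵥ P *ᵥ v := by
  rw [Matrix.dotProduct_mulVec, ← Matrix.mulVec_transpose, hP, dotProduct_comm]

theorem hasDerivAt_quadratic {P : Matrix (Fin k) (Fin k) ℝ} (hP : Pᵀ = P)
    (hu : HasDerivAt u u' t) :
    HasDerivAt (fun t => u t ⬝ᵥ P *ᵥ u t) (2 * (u t ⬝ᵥ P *ᵥ u')) t := by
  refine (hasDerivAt_dotProduct hu (hasDerivAt_mulVec P hu)).congr_deriv ?_
  rw [dotProduct_mulVec_symm hP u']
  ring

end Derivatives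

/-! ### The quadratic form of the graph Laplacian. -/

section Laplacian

variable {n N : ℕ}

/-- The graph Laplacian applied to a family of vectors. -/
def laplacian (a : Matrix (Fin N) (Fin N) ℝ) (e : Fin N → Fin n → ℝ) (i : Fin N) : Fin n → ℝ :=
  ∑ j, a i j • (e i - e j)

variable {a : Matrix (Fin N) (Fin N) ℝ}

/-- Average the double sum with the one obtained by exchanging i and j. Symmetry and nonnegativity
of the form, and its null space, are read off from the right-hand side. -/
theorem two_mul_sum_dotProduct_laplacian (ha : ∀ i j, a i j = a j i) (f e : Fin N → Fin n → ℝ) :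
    2 * ∑ i, f i ⬝ᵥ laplacian a e i = ∑ i, ∑ j, a i j * ((f i - f j) ⬝ᵥ (e i - e j)) := by
  have h1 : ∑ i, f i ⬝ᵥ laplacian a e i = ∑ i, ∑ j, a i j * (f i ⬝ᵥ (e i - e j)) := by
    simp only [laplacian, dotProduct_sum, dotProduct_smul, smul_eq_mul]
  have h2 : ∑ i, f i ⬝ᵥ laplacian a e i = ∑ i, ∑ j, a i j * (f j ⬝ᵥ (e j - e i)) := by
    rw [h1, Finset.sum_comm]
    exact Finset.sum_congr rfl fun i _ => Finset.sum_congr rfl fun j _ => by rw [ha]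
  rw [two_mul]
  nth_rw 1 [h1]
  rw [h2, ← Finset.sum_add_distrib]
  refine Finset.sum_congr rfl fun i _ => ?_
  rw [← Finset.sum_add_distrib]
  refine Finset.sum_congr rfl fun j _ => ?_
  simp only [sub_dotProduct, dotProduct_sub]
  ring

theorem sum_dotProduct_laplacian_comm (ha : ∀ i j, a i j = a j i) (f e : Fin N → Fin n → ℝ) :
    ∑ i, f i ⬝ᵥ laplacian a e i = ∑ i, e i ⬝ᵥ laplacian a f i := by
  have h1 := two_mul_sum_dotProduct_laplacian ha f e
  have h2 := two_mul_sum_dotProduct_laplacian ha e f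
  simp only [fun i j => dotProduct_comm (f i - f j) (e i - e j)] at h1
  linarith

theorem IsConnectedAdjacency.nonneg (ha : IsConnectedAdjacency a) (i j : Fin N) : 0 ≤ a i j := by
  obtain ⟨-, G, -, h⟩ := ha
  by_cases hij : G.Adj i j
  · exact ((h i j).1 hij).le
  · exact ((h i j).2 hij).ge

theorem sum_dotProduct_laplacian_nonneg (ha : IsConnectedAdjacency a) (e : Fin N → Fin n → ℝ) :
    0 ≤ ∑ i, e i ⬝ᵥ laplacian a e i := by
  have := two_mul_sum_dotProduct_laplacian ha.1 e e
  have : 0 ≤ ∑ i, ∑ j, a i j * ((e i - e j) ⬝ᵥ (e i - e j)) :=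
    Finset.sum_nonneg fun i _ => Finset.sum_nonneg fun j _ =>
      mul_nonneg (ha.nonneg i j) (dotProduct_self_nonneg_real _)
  linarith

/-- A vanishing sum of nonnegative terms makes e agree across every edge, and then along a walk from
i to j. -/
theorem eq_of_sum_dotProduct_laplacian_eq_zero (ha : IsConnectedAdjacency a)
    {e : Fin N → Fin n → ℝ} (h : ∑ i, e i ⬝ᵥ laplacian a e i = 0) (i j : Fin N) : e i = e j := by
  have h1 := two_mul_sum_dotProduct_laplacian ha.1 e e
  rw [h, mul_zero] at h1
  have hterm : ∀ i j, 0 ≤ a i j * ((e i - e j) ⬝ᵥ (e i - e j)) := fun i j =>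
    mul_nonneg (ha.nonneg i j) (dotProduct_self_nonneg_real _)
  have h2 : ∀ i j, a i j * ((e i - e j) ⬝ᵥ (e i - e j)) = 0 := fun i j =>
    (Finset.sum_eq_zero_iff_of_nonneg fun j _ => hterm i j).1
      ((Finset.sum_eq_zero_iff_of_nonneg fun i _ => Finset.sum_nonneg fun j _ => hterm i j).1
        h1.symm i (Finset.mem_univ i)) j (Finset.mem_univ j)
  obtain ⟨-, G, hconn, hG⟩ := ha
  obtain ⟨p⟩ := hconn.preconnected i j
  induction p with
  | nil => rfl
  | cons hadj _ ih =>
    have h3 := (mul_eq_zero.1 (h2 _ _)).resolve_left ((hG _ _).1 hadj).ne'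
    exact (sub_eq_zero.1 (dotProduct_self_eq_zero.1 h3)).trans ih

theorem hasDerivAt_laplacian {e : Fin N → ℝ → Fin n → ℝ} {e' : Fin N → Fin n → ℝ} {t : ℝ}
    (h : ∀ i, HasDerivAt (e i) (e' i) t) (i : Fin N) :
    HasDerivAt (fun t => laplacian a (fun j => e j t) i) (laplacian a e' i) t :=
  HasDerivAt.fun_sum fun j _ => ((h i).sub (h j)).const_smul (a i j)

/-- Symmetry of the weights makes the two halves of the product rule equal. Since e_i' is paired
with (L e)_i, a coupling term T_{iu} ε_{iu} in e_i' produces exactly ‖ε_{iu}‖². -/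
theorem hasDerivAt_sum_dotProduct_laplacian (ha : ∀ i j, a i j = a j i)
    {e : Fin N → ℝ → Fin n → ℝ} {e' : Fin N → Fin n → ℝ} {t : ℝ}
    (h : ∀ i, HasDerivAt (e i) (e' i) t) :
    HasDerivAt (fun t => ∑ i, e i t ⬝ᵥ laplacian a (fun j => e j t) i)
      (2 * ∑ i, laplacian a (fun j => e j t) i ⬝ᵥ e' i) t := by
  refine (HasDerivAt.fun_sum fun i _ =>
    hasDerivAt_dotProduct (h i) (hasDerivAt_laplacian h i)).congr_deriv ?_
  rw [Finset.sum_add_distrib, sum_dotProduct_laplacian_comm ha (fun j => e j t) e', two_mul]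
  simp only [dotProduct_comm]

theorem VecLocallyAC.laplacian {e : Fin N → ℝ → Fin n → ℝ} (h : ∀ i, VecLocallyAC (e i))
    (i : Fin N) : VecLocallyAC fun t => laplacian a (fun j => e j t) i :=
  VecLocallyAC.sum fun j => ((h i).sub (h j)).const_smul (a i j)

end Laplacian

/-! ### The closed loop in the coordinates of plant state and estimation errors. -/

namespace Design

variable {n m N Nc : ℕ} {S : Network n m N Nc} (D : Design S)
  (K : ∀ ι, Matrix (Fin (S.mc ι)) (Fin n) ℝ) (σ : Fin Nc → Fin N)

/-- The control inputs in terms of the plant state and the estimation errors. -/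
def errorFeedback (ξ : (Fin n → ℝ) × (Fin N → Fin n → ℝ)) (ι : Fin Nc) : Fin (S.mc ι) → ℝ :=
  K ι *ᵥ (ξ.1 + ξ.2 (σ ι))

/-- The velocity of the plant in terms of the plant state and the estimation errors. -/
def plantField (ξ : (Fin n → ℝ) × (Fin N → Fin n → ℝ)) : Fin n → ℝ :=
  S.A *ᵥ ξ.1 + S.inputTerm (errorFeedback K σ ξ)

/-- The effect on the plant of the input that observer node `i` does not receive. -/
def unknownTerm (ξ : (Fin n → ℝ) × (Fin N → Fin n → ℝ)) (i : Fin N) : Fin n → ℝ :=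
  S.inputTerm (errorFeedback K σ ξ) - S.Bl i *ᵥ S.localInput (errorFeedback K σ ξ) i

/-- The part of the estimation error dynamics that is linear in the plant state and the errors. -/
def errorField (ξ : (Fin n → ℝ) × (Fin N → Fin n → ℝ)) (i : Fin N) : Fin n → ℝ :=
  D.Ebar i *ᵥ ξ.2 i - D.Tu i *ᵥ ((D.Tu i)ᵀ *ᵥ unknownTerm K σ ξ i)

/-- The consensus error in terms of the estimation errors. -/
def errorConsensus (ξ : (Fin n → ℝ) × (Fin N → Fin n → ℝ)) (i : Fin N) : Fin (n - D.δ i) → ℝ :=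
  (D.Tu i)ᵀ *ᵥ laplacian S.a ξ.2 i

section Homogeneity

theorem isHomogeneousMap_fst :
    IsHomogeneousMap fun ξ : (Fin n → ℝ) × (Fin N → Fin n → ℝ) => ξ.1 :=
  ⟨continuous_fst, fun _ _ => rfl⟩

theorem isHomogeneousMap_snd (i : Fin N) :
    IsHomogeneousMap fun ξ : (Fin n → ℝ) × (Fin N → Fin n → ℝ) => ξ.2 i :=
  ⟨(continuous_apply i).comp continuous_snd, fun _ _ => rfl⟩

theorem isHomogeneousMap_errorFeedback (ι : Fin Nc) :
    IsHomogeneousMap fun ξ => errorFeedback K σ ξ ι :=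
  (isHomogeneousMap_fst.add (isHomogeneousMap_snd _)).mulVec _

theorem isHomogeneousMap_inputTerm :
    IsHomogeneousMap fun ξ => S.inputTerm (errorFeedback K σ ξ) :=
  IsHomogeneousMap.sum fun ι => (isHomogeneousMap_errorFeedback K σ ι).mulVec _

theorem isHomogeneousMap_plantField : IsHomogeneousMap (plantField (S := S) K σ) :=
  (isHomogeneousMap_fst.mulVec _).add (isHomogeneousMap_inputTerm K σ)

theorem isHomogeneousMap_unknownTerm (i : Fin N) :
    IsHomogeneousMap fun ξ => unknownTerm (S := S) K σ ξ i :=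
  (isHomogeneousMap_inputTerm K σ).sub <| IsHomogeneousMap.mulVec _ <|
    IsHomogeneousMap.sum fun ι => (isHomogeneousMap_errorFeedback K σ ι).mulVec _

theorem isHomogeneousMap_errorField (i : Fin N) :
    IsHomogeneousMap fun ξ => D.errorField K σ ξ i :=
  ((isHomogeneousMap_snd i).mulVec _).sub
    (((isHomogeneousMap_unknownTerm K σ i).mulVec _).mulVec _)

theorem isHomogeneousMap_laplacian (a : Matrix (Fin N) (Fin N) ℝ) (i : Fin N) :
    IsHomogeneousMap fun ξ : (Fin n → ℝ) × (Fin N → Fin n → ℝ) => laplacian a ξ.2 i :=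
  IsHomogeneousMap.sum fun j =>
    ((isHomogeneousMap_snd i).sub (isHomogeneousMap_snd j)).const_smul (a i j)

theorem isHomogeneousMap_errorConsensus (i : Fin N) :
    IsHomogeneousMap fun ξ => D.errorConsensus ξ i :=
  (isHomogeneousMap_laplacian S.a i).mulVec _

end Homogeneity

variable {D}

/-! ### Consequences of the observer equations and of collective detectability. -/

section Algebra

theorem Admissible.transpose_Td_mul_Gbar (hD : D.Admissible) (i : Fin N) :
    (D.Td i)ᵀ * D.Gbar i = D.G i := by
  rw [Gbar, ← Matrix.mul_assoc, (hD.observer i).orthonormal, Matrix.one_mul]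

theorem Admissible.transpose_Td_mul_Ebar (hD : D.Admissible) (i : Fin N) :
    (D.Td i)ᵀ * D.Ebar i = D.E i * (D.Td i)ᵀ := by
  rw [Ebar, Matrix.mul_add, ← Matrix.mul_assoc, ← Matrix.mul_assoc,
    (hD.observer i).orthonormal, Matrix.one_mul, Matrix.mul_assoc (D.Tu i), ← Matrix.mul_assoc,
    hD.orthogonal i, Matrix.zero_mul, add_zero]

/-- This is the Sylvester equation multiplied by T_{id} and completed on Im T_{iu}. It cancels the
terms of the error dynamics that are linear in x and do not come from the inputs. -/
theorem Admissible.Fbar_mul_C (hD : D.Admissible) (i : Fin N) :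
    D.Fbar i * S.C i + D.Ebar i - D.Ebar i * (D.Gbar i * S.C i) =
      (1 - D.Gbar i * S.C i) * S.A := by
  have hEG : D.Ebar i * D.Gbar i =
      D.Td i * D.E i * D.G i + D.Tu i * (D.Tu i)ᵀ * S.A * D.Gbar i := by
    rw [Ebar, Matrix.add_mul, Matrix.mul_assoc (D.Td i * D.E i), hD.transpose_Td_mul_Gbar]
  have hsyl := congrArg (D.Td i * ·) (hD.observer i).sylvester
  simp only [Matrix.mul_add, Matrix.mul_sub, Matrix.sub_mul, Matrix.mul_zero] at hsyl
  rw [← Matrix.mul_assoc, hEG, Fbar, Ebar, hD.complement i, Gbar]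
  simp only [Matrix.add_mul, Matrix.sub_mul, Matrix.one_mul, Matrix.mul_assoc] at hsyl ⊢
  rw [← sub_eq_zero, ← hsyl]
  abel

/-- The decoupling condition gives Ḡ_i C_i B_{-i} = T_{id} T_{id}ᵀ B_{-i}, so the unknown input
disturbs the error only along Im T_{iu}. -/
theorem Admissible.one_sub_mul_Bm (hD : D.Admissible) (i : Fin N) :
    (1 - D.Gbar i * S.C i) * S.Bm i = D.Tu i * ((D.Tu i)ᵀ * S.Bm i) := by
  rw [← Matrix.mul_assoc, hD.complement i, Matrix.sub_mul, Matrix.sub_mul, Gbar,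
    Matrix.mul_assoc (D.Td i), Matrix.mul_assoc (D.Td i), (hD.observer i).decoupling,
    ← Matrix.mul_assoc]

theorem Admissible.transpose_Td_mulVec_Tu (hD : D.Admissible) (i : Fin N)
    (v : Fin (n - D.δ i) → ℝ) : (D.Td i)ᵀ *ᵥ (D.Tu i *ᵥ v) = 0 := by
  rw [Matrix.mulVec_mulVec, hD.orthogonal i, Matrix.zero_mulVec]

/-- The locally reconstructed part of the error evolves autonomously: unknown inputs and the errors
of other nodes act in Im T_{iu}, which is orthogonal to Im T_{id}. -/
theorem Admissible.transpose_Td_mulVec_errorField (hD : D.Admissible) (i : Fin N)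
    (ξ : (Fin n → ℝ) × (Fin N → Fin n → ℝ)) :
    (D.Td i)ᵀ *ᵥ D.errorField K σ ξ i = D.E i *ᵥ ((D.Td i)ᵀ *ᵥ ξ.2 i) := by
  rw [errorField, Matrix.mulVec_sub, hD.transpose_Td_mulVec_Tu, sub_zero, Matrix.mulVec_mulVec,
    hD.transpose_Td_mul_Ebar, ← Matrix.mulVec_mulVec]

/-- The errors vanish when they are invisible to all local observers and in consensus. -/
theorem eq_zero_of_forall_eq (hdet : D.CollectivelyStronglyDetectable) {e : Fin N → Fin n → ℝ}
    (heq : ∀ i j, e i = e j) (hTd : ∀ i, (D.Td i)ᵀ *ᵥ e i = 0) : e = 0 := by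
  funext i
  have horth : ∀ v ∈ ⨆ j, LinearMap.range (D.Td j).mulVecLin, v ⬝ᵥ e i = 0 := by
    intro v hv
    induction hv using Submodule.iSup_induction' with
    | mem j v hv =>
      obtain ⟨w, rfl⟩ := hv
      rw [Matrix.mulVecLin_apply, dotProduct_comm, Matrix.dotProduct_mulVec,
        ← Matrix.mulVec_transpose, heq i j, hTd j, zero_dotProduct]
    | zero => exact zero_dotProduct _
    | add v w _ _ hv hw => rw [add_dotProduct, hv, hw, add_zero]
  rw [show (⨆ j, LinearMap.range (D.Td j).mulVecLin) = ⊤ from hdet] at horth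
  exact dotProduct_self_eq_zero.1 (horth (e i) Submodule.mem_top)

/-- When T_{id}ᵀ e_i = 0, the vector e_i lies in Im T_{iu}, so e_i ⬝ (L e)_i = (T_{iu}ᵀ e_i) ⬝
ε_{iu} = 0. The Laplacian form vanishes, and the errors share a value orthogonal to every Im T_{id}.
-/
theorem eq_zero_of_errorConsensus (hD : D.Admissible) (hdet : D.CollectivelyStronglyDetectable)
    (ha : IsConnectedAdjacency S.a) {ξ : (Fin n → ℝ) × (Fin N → Fin n → ℝ)}
    (hε : ∀ i, D.errorConsensus ξ i = 0) (hTd : ∀ i, (D.Td i)ᵀ *ᵥ ξ.2 i = 0) : ξ.2 = 0 := by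
  refine eq_zero_of_forall_eq hdet (eq_of_sum_dotProduct_laplacian_eq_zero ha ?_) hTd
  refine Finset.sum_eq_zero fun i _ => ?_
  have h1 : ξ.2 i = D.Tu i *ᵥ ((D.Tu i)ᵀ *ᵥ ξ.2 i) := by
    rw [Matrix.mulVec_mulVec, hD.complement i, Matrix.sub_mulVec, Matrix.one_mulVec,
      ← Matrix.mulVec_mulVec, hTd i, Matrix.mulVec_zero, sub_zero]
  rw [h1, dotProduct_comm, Matrix.dotProduct_mulVec, ← Matrix.mulVec_transpose]
  rw [show (D.Tu i)ᵀ *ᵥ laplacian S.a ξ.2 i = 0 from hε i, zero_dotProduct]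

end Algebra

end Design

/-! ### Derivatives along closed-loop trajectories. -/

theorem Network.StateFeedbackStabilizes.isHurwitz {n m N Nc : ℕ} {S : Network n m N Nc}
    {K : ∀ ι, Matrix (Fin (S.mc ι)) (Fin n) ℝ} (hK : S.StateFeedbackStabilizes K) :
    IsHurwitz (S.A + ∑ ι, S.Bc ι * K ι) := by
  refine isHurwitz_of_forall_tendsto fun x hx i => ?_
  have h := hK x fun t _ => by
    refine ((hx t).congr_deriv ?_).hasDerivWithinAt
    rw [Matrix.add_mulVec, Matrix.sum_mulVec, Network.inputTerm]
    simp only [Matrix.mulVec_mulVec]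
  refine squeeze_zero_norm (fun t => ?_) h
  exact PiLp.norm_apply_le (WithLp.toLp 2 (x t) : EuclideanSpace ℝ (Fin n)) i

namespace Design

variable {n m N Nc : ℕ} {S : Network n m N Nc} {D : Design S}
  {K : ∀ ι, Matrix (Fin (S.mc ι)) (Fin n) ℝ} {σ : Fin Nc → Fin N}
  {x : ℝ → Fin n → ℝ} {z : Fin N → ℝ → Fin n → ℝ} {γ γs : Fin N → ℝ → ℝ}

/-- The estimation error of observer node `i`. -/
def error (D : Design S) (x : ℝ → Fin n → ℝ) (z : Fin N → ℝ → Fin n → ℝ) (i : Fin N) (t : ℝ) :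
    Fin n → ℝ :=
  D.estimate (x t) (fun j => z j t) i - x t

/-- The plant state together with all estimation errors. -/
def errorState (D : Design S) (x : ℝ → Fin n → ℝ) (z : Fin N → ℝ → Fin n → ℝ) (t : ℝ) :
    (Fin n → ℝ) × (Fin N → Fin n → ℝ) :=
  (x t, fun i => D.error x z i t)

theorem feedback_eq_errorFeedback (t : ℝ) :
    D.feedback K σ (x t) (fun j => z j t) = errorFeedback K σ (D.errorState x z t) := by
  funext ι
  simp [feedback, errorFeedback, errorState, error]

theorem consensusError_eq_errorConsensus (t : ℝ) (i : Fin N) :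
    D.consensusError (x t) (fun j => z j t) i = D.errorConsensus (D.errorState x z t) i := by
  simp [consensusError, errorConsensus, errorState, error, laplacian]

/-- The dynamics of the estimation errors. -/
theorem hasDerivAt_error (hS : S.Standing) (hD : D.Admissible) (i : Fin N) {t : ℝ}
    {q : Fin n → ℝ}
    (hx : HasDerivAt x (plantField K σ (D.errorState x z t)) t)
    (hz : HasDerivAt (z i) (D.Ebar i *ᵥ z i t + D.Fbar i *ᵥ (S.C i *ᵥ x t)
        + D.Bbar i *ᵥ S.localInput (errorFeedback K σ (D.errorState x z t)) i - q) t) :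
    HasDerivAt (D.error x z i) (D.errorField K σ (D.errorState x z t) i - q) t := by
  have h1 := (hz.add (hasDerivAt_mulVec (D.Gbar i) (hasDerivAt_mulVec (S.C i) hx))).sub hx
  refine h1.congr_deriv ?_
  have hfst : (D.errorState x z t).1 = x t := rfl
  have hsnd : (D.errorState x z t).2 i = z i t + D.Gbar i *ᵥ (S.C i *ᵥ x t) - x t := rfl
  rw [errorField, plantField, hfst, hsnd, unknownTerm]
  set u := errorFeedback K σ (D.errorState x z t)
  obtain ⟨w, hw⟩ := hS.split i u
  -- Only the existence of some w with this property matters; it is eliminated again through `hdec`.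
  have hunk : S.inputTerm u - S.Bl i *ᵥ S.localInput u i = S.Bm i *ᵥ w := by
    rw [hw]
    abel
  have hdec := congrArg (· *ᵥ w) (hD.one_sub_mul_Bm i)
  have hsyl := congrArg (· *ᵥ x t) (hD.Fbar_mul_C i)
  rw [hunk, hw, Bbar]
  simp only [Matrix.mulVec_mulVec, Matrix.mulVec_add, Matrix.mulVec_sub, Matrix.add_mulVec,
    Matrix.sub_mulVec, Matrix.sub_mul, Matrix.mul_assoc, Matrix.one_mul] at hdec hsyl ⊢
  rw [← hdec, ← sub_eq_zero]
  rw [← sub_eq_zero] at hsyl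
  rw [← hsyl]
  abel

/-- The part of the state that node `i` reconstructs on its own admits a Lyapunov function. -/
theorem IsTrajectory.exists_local_lyapunov (hD : D.Admissible)
    (htraj : D.IsTrajectory K σ x z γ γs) (i : Fin N) :
    ∃ Q : Matrix (Fin (D.δ i)) (Fin (D.δ i)) ℝ, Qᵀ = Q ∧ (∀ v, 0 ≤ v ⬝ᵥ Q *ᵥ v) ∧
      ∀ t, 0 ≤ t → 2 * (((D.Td i)ᵀ *ᵥ D.error x z i t) ⬝ᵥ
        Q *ᵥ (D.E i *ᵥ ((D.Td i)ᵀ *ᵥ D.error x z i t))) ≤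
        -(((D.Td i)ᵀ *ᵥ D.error x z i t) ⬝ᵥ ((D.Td i)ᵀ *ᵥ D.error x z i t)) := by
  rcases (hD.observer i).stable with hE | ⟨-, hE, hF, hG⟩
  · obtain ⟨Q, h1, h2, h3⟩ := hE.exists_lyapunov
    exact ⟨Q, h1, h2, fun t _ => h3 _⟩
  · have hTz : ∀ t, (D.Td i)ᵀ *ᵥ D.error x z i t = (D.Td i)ᵀ *ᵥ z i t := fun t => by
      rw [error, estimate, Matrix.mulVec_sub, Matrix.mulVec_add, Matrix.mulVec_mulVec,
        hD.transpose_Td_mul_Gbar, Matrix.mulVec_mulVec, hG]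
      abel
    -- In the static case E_i = 0 gives no decay. Here T_{id}ᵀ z_i is constant, and z_i(0) = 0 makes
    -- it vanish, so the local error is identically zero and Q = 0 will do.
    have hzero : ∀ t, 0 ≤ t → (D.Td i)ᵀ *ᵥ z i t = 0 := by
      intro t ht
      have hac := (VecLocallyAC.of_absolutelyContinuous (htraj.z_ac i)).mulVec (D.Td i)ᵀ
      funext k
      refine (hac k).eq_zero_of_deriv ?_ ?_ ht
      · simp only [htraj.z_init i, Matrix.mulVec_zero, Pi.zero_apply]
      · filter_upwards [htraj.z_deriv i] with s hs hs0
        obtain ⟨q, -, hq⟩ := hs hs0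
        have h1 := hasDerivAt_pi.1 (hasDerivAt_mulVec (D.Td i)ᵀ hq) k
        refine h1.congr_deriv ?_
        have hEbar : (D.Td i)ᵀ * D.Ebar i = 0 := by
          rw [hD.transpose_Td_mul_Ebar, hE, Matrix.zero_mul]
        have hFbar : (D.Td i)ᵀ * D.Fbar i = 0 := by
          rw [Fbar, hF, Matrix.mul_zero, zero_add, Matrix.mul_assoc, Matrix.mul_assoc,
            ← Matrix.mul_assoc, hD.orthogonal i, Matrix.zero_mul]
        have hBbar : (D.Td i)ᵀ * D.Bbar i = 0 := by
          rw [Bbar, ← Matrix.mul_assoc, Matrix.mul_sub, Matrix.mul_one, ← Matrix.mul_assoc,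
            hD.transpose_Td_mul_Gbar, hG, sub_self, Matrix.zero_mul]
        simp only [Matrix.mulVec_add, Matrix.mulVec_sub, Matrix.mulVec_smul,
          hD.transpose_Td_mulVec_Tu]
        rw [Matrix.mulVec_mulVec _ _ (D.Ebar i), hEbar, Matrix.mulVec_mulVec _ _ (D.Fbar i), hFbar,
          Matrix.mulVec_mulVec _ _ (D.Bbar i), hBbar]
        simp
    refine ⟨0, Matrix.transpose_zero, fun v => by simp, fun t ht => ?_⟩
    rw [hTz, hzero t ht]
    simp

theorem IsTrajectory.error_ac (htraj : D.IsTrajectory K σ x z γ γs) (i : Fin N) :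
    VecLocallyAC (D.error x z i) := by
  have hx := VecLocallyAC.of_absolutelyContinuous htraj.x_ac
  exact ((VecLocallyAC.of_absolutelyContinuous (htraj.z_ac i)).add
    ((hx.mulVec _).mulVec _)).sub hx

/-- The gains never become negative. -/
theorem IsTrajectory.gains_pos (hD : D.Admissible) (htraj : D.IsTrajectory K σ x z γ γs)
    (i : Fin N) {t : ℝ} (ht : 0 ≤ t) : 0 < γ i t ∧ 0 < γs i t := by
  have key : ∀ {g g' : ℝ → ℝ}, LocallyAC g → (∀ t, 0 ≤ g' t) →
      (∀ᵐ t : ℝ, 0 < t → HasDerivAt g (g' t) t) → 0 < g 0 → 0 < g t := by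
    intro g g' hg hg' hder h0
    have h1 := hg.neg.antitoneOn le_rfl (by
      filter_upwards [hder] with s hs hs0
      exact ⟨_, neg_nonpos.2 (hg' s), (hs hs0).neg⟩) Set.self_mem_Ici (Set.mem_Ici.2 ht) ht
    linarith
  exact ⟨key (htraj.γ_ac i) (fun t => mul_nonneg (hD.φ_pos i).le (sq_nonneg _)) (htraj.γ_deriv i)
      (htraj.γ_init i),
    key (htraj.γs_ac i) (fun t => mul_nonneg (hD.φs_pos i).le (enorm2_nonneg _))
      (htraj.γs_deriv i) (htraj.γs_init i)⟩

/-- The closed loop at time `t` in terms of the plant state and the estimation errors. -/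
structure ClosedLoopAt (D : Design S) (K : ∀ ι, Matrix (Fin (S.mc ι)) (Fin n) ℝ)
    (σ : Fin Nc → Fin N) (x : ℝ → Fin n → ℝ) (z : Fin N → ℝ → Fin n → ℝ) (γ γs : Fin N → ℝ → ℝ)
    (t : ℝ) (s : ∀ i, Fin (n - D.δ i) → ℝ) : Prop where
  dir : ∀ i, D.errorConsensus (D.errorState x z t) i ⬝ᵥ s i =
    enorm2 (D.errorConsensus (D.errorState x z t) i)
  plant : HasDerivAt x (plantField K σ (D.errorState x z t)) t
  err : ∀ i, HasDerivAt (D.error x z i) (D.errorField K σ (D.errorState x z t) i -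
    (γ i t • (D.Tu i *ᵥ D.errorConsensus (D.errorState x z t) i)
      + γs i t • (D.Tu i *ᵥ s i))) t
  gain : ∀ i, HasDerivAt (γ i) (D.φ i * enorm2 (D.errorConsensus (D.errorState x z t) i) ^ 2) t
  gains : ∀ i, HasDerivAt (γs i) (D.φs i * enorm2 (D.errorConsensus (D.errorState x z t) i)) t

/-- The selections s are made separately at each time; no measurability in t is needed because they
drop out of all derivatives of scalar functions used later. -/
theorem IsTrajectory.closedLoopAt (hS : S.Standing) (hD : D.Admissible)
    (htraj : D.IsTrajectory K σ x z γ γs) :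
    ∀ᵐ t : ℝ, 0 < t → ∃ s, D.ClosedLoopAt K σ x z γ γs t s := by
  filter_upwards [htraj.x_deriv, ae_all_iff.2 htraj.z_deriv, ae_all_iff.2 htraj.γ_deriv,
    ae_all_iff.2 htraj.γs_deriv] with t hx hz hγ hγs ht
  have hx' := hx ht
  choose s hs hz' using fun i => hz i ht
  simp only [feedback_eq_errorFeedback, consensusError_eq_errorConsensus] at hx' hs hz' hγ hγs
  exact ⟨s, fun i => dotProduct_eq_enorm2_of_mem_direction (hs i), hx',
    fun i => hasDerivAt_error hS hD i hx' (hz' i), fun i => hγ i ht, fun i => hγs i ht⟩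

namespace ClosedLoopAt

variable {t : ℝ} {s : ∀ i, Fin (n - D.δ i) → ℝ}

theorem hasDerivAt_local (h : D.ClosedLoopAt K σ x z γ γs t s) (hD : D.Admissible) (i : Fin N) :
    HasDerivAt (fun t => (D.Td i)ᵀ *ᵥ D.error x z i t)
      (D.E i *ᵥ ((D.Td i)ᵀ *ᵥ D.error x z i t)) t := by
  refine (hasDerivAt_mulVec _ (h.err i)).congr_deriv ?_
  rw [Matrix.mulVec_sub, Matrix.mulVec_add, Matrix.mulVec_smul, Matrix.mulVec_smul,
    hD.transpose_Td_mulVec_Tu, hD.transpose_Td_mulVec_Tu, hD.transpose_Td_mulVec_errorField]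
  simp [errorState]

/-- The derivative of the disagreement `½ ∑ eᵢ ⬝ (L e)ᵢ`. -/
theorem hasDerivAt_disagreement (h : D.ClosedLoopAt K σ x z γ γs t s)
    (ha : ∀ i j, S.a i j = S.a j i) :
    HasDerivAt (fun t => 1 / 2 *
        ∑ i, D.error x z i t ⬝ᵥ laplacian S.a (fun j => D.error x z j t) i)
      (∑ i, (laplacian S.a (D.errorState x z t).2 i ⬝ᵥ D.errorField K σ (D.errorState x z t) i
        - (γ i t * enorm2 (D.errorConsensus (D.errorState x z t) i) ^ 2
          + γs i t * enorm2 (D.errorConsensus (D.errorState x z t) i)))) t := by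
  refine ((hasDerivAt_sum_dotProduct_laplacian ha h.err).const_mul (1 / 2)).congr_deriv ?_
  rw [← mul_assoc, one_div, inv_mul_cancel₀ two_ne_zero, one_mul]
  refine Finset.sum_congr rfl fun i _ => ?_
  have hTu : ∀ v, laplacian S.a (D.errorState x z t).2 i ⬝ᵥ D.Tu i *ᵥ v =
      D.errorConsensus (D.errorState x z t) i ⬝ᵥ v := fun v => by
    rw [Matrix.dotProduct_mulVec, ← Matrix.mulVec_transpose, errorConsensus]
  rw [show (fun j => D.error x z j t) = (D.errorState x z t).2 from rfl, dotProduct_sub,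
    dotProduct_add, dotProduct_smul, dotProduct_smul, hTu, hTu, h.dir i, enorm2_sq, smul_eq_mul,
    smul_eq_mul]

end ClosedLoopAt

/-! ### Energy, high-gain domination and storage functions. -/

/-- A positive definite function of the plant state and the estimation errors. -/
noncomputable def energy (D : Design S) (ξ : (Fin n → ℝ) × (Fin N → Fin n → ℝ)) : ℝ :=
  ξ.1 ⬝ᵥ ξ.1 + (1 / 2 * ∑ i, ξ.2 i ⬝ᵥ laplacian S.a ξ.2 i
    + ∑ i, ((D.Td i)ᵀ *ᵥ ξ.2 i) ⬝ᵥ ((D.Td i)ᵀ *ᵥ ξ.2 i))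

theorem isQuadratic_energy : IsQuadratic D.energy :=
  (isHomogeneousMap_fst.dotProduct isHomogeneousMap_fst).add
    (((IsQuadratic.sum fun i =>
      (isHomogeneousMap_snd i).dotProduct (isHomogeneousMap_laplacian S.a i)).const_mul _).add
      (IsQuadratic.sum fun i =>
        ((isHomogeneousMap_snd i).mulVec _).dotProduct ((isHomogeneousMap_snd i).mulVec _)))

theorem half_sum_dotProduct_laplacian_nonneg (hgraph : IsConnectedAdjacency S.a)
    (e : Fin N → Fin n → ℝ) : 0 ≤ 1 / 2 * ∑ i, e i ⬝ᵥ laplacian S.a e i :=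
  mul_nonneg (by norm_num) (sum_dotProduct_laplacian_nonneg hgraph e)

theorem sum_dotProduct_self_nonneg {k : Fin N → ℕ} (v : ∀ i, Fin (k i) → ℝ) :
    0 ≤ ∑ i, v i ⬝ᵥ v i :=
  Finset.sum_nonneg fun _ _ => dotProduct_self_nonneg_real _

theorem eq_zero_of_sum_dotProduct_self {k : Fin N → ℕ} {v : ∀ i, Fin (k i) → ℝ}
    (h : ∑ i, v i ⬝ᵥ v i = 0) (i : Fin N) : v i = 0 :=
  dotProduct_self_eq_zero.1
    ((Finset.sum_eq_zero_iff_of_nonneg fun j _ => dotProduct_self_nonneg_real (v j)).1 h i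
      (Finset.mem_univ i))

theorem energy_nonneg (hgraph : IsConnectedAdjacency S.a)
    (ξ : (Fin n → ℝ) × (Fin N → Fin n → ℝ)) : 0 ≤ D.energy ξ :=
  add_nonneg (dotProduct_self_nonneg_real _)
    (add_nonneg (half_sum_dotProduct_laplacian_nonneg hgraph _) (sum_dotProduct_self_nonneg _))

theorem energy_pos (hgraph : IsConnectedAdjacency S.a) (hdet : D.CollectivelyStronglyDetectable)
    {ξ : (Fin n → ℝ) × (Fin N → Fin n → ℝ)} (hξ : ξ ≠ 0) : 0 < D.energy ξ := by
  refine lt_of_le_of_ne (energy_nonneg hgraph ξ) fun h => hξ ?_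
  have h1 := dotProduct_self_nonneg_real ξ.1
  have h2 := half_sum_dotProduct_laplacian_nonneg hgraph ξ.2
  have h3 := sum_dotProduct_self_nonneg fun i => (D.Td i)ᵀ *ᵥ ξ.2 i
  rw [energy] at h
  exact Prod.ext (dotProduct_self_eq_zero.1 (by linarith)) (eq_zero_of_forall_eq hdet
    (eq_of_sum_dotProduct_laplacian_eq_zero hgraph (by linarith))
    (eq_zero_of_sum_dotProduct_self (by linarith)))

/-- With sufficiently high gains the coupling terms are dominated. -/
theorem exists_gain (hgraph : IsConnectedAdjacency S.a) (hD : D.Admissible)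
    (hdet : D.CollectivelyStronglyDetectable) {P : Matrix (Fin n) (Fin n) ℝ}
    (hP : ∀ v, 2 * (v ⬝ᵥ P *ᵥ ((S.A + ∑ ι, S.Bc ι * K ι) *ᵥ v)) ≤ -(v ⬝ᵥ v)) :
    ∃ k > 0, ∃ c > 0, ∀ ξ : (Fin n → ℝ) × (Fin N → Fin n → ℝ),
      ((∑ i, laplacian S.a ξ.2 i ⬝ᵥ D.errorField K σ ξ i)
        + 2 * (ξ.1 ⬝ᵥ P *ᵥ plantField K σ ξ))
      - k * ((∑ i, D.errorConsensus ξ i ⬝ᵥ D.errorConsensus ξ i)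
        + ∑ i, ((D.Td i)ᵀ *ᵥ ξ.2 i) ⬝ᵥ ((D.Td i)ᵀ *ᵥ ξ.2 i)) ≤ -(c * ‖ξ‖ ^ 2) := by
  refine exists_sub_mul_le
    (f := fun ξ => (∑ i, laplacian S.a ξ.2 i ⬝ᵥ D.errorField K σ ξ i)
      + 2 * (ξ.1 ⬝ᵥ P *ᵥ plantField K σ ξ))
    (g := fun ξ => (∑ i, D.errorConsensus ξ i ⬝ᵥ D.errorConsensus ξ i)
      + ∑ i, ((D.Td i)ᵀ *ᵥ ξ.2 i) ⬝ᵥ ((D.Td i)ᵀ *ᵥ ξ.2 i)) ?_ ?_ ?_ ?_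
  · exact (IsQuadratic.sum fun i => (isHomogeneousMap_laplacian S.a i).dotProduct
      (D.isHomogeneousMap_errorField K σ i)).add ((isHomogeneousMap_fst.dotProduct
        ((isHomogeneousMap_plantField K σ).mulVec P)).const_mul 2)
  · exact (IsQuadratic.sum fun i => (D.isHomogeneousMap_errorConsensus i).dotProduct
      (D.isHomogeneousMap_errorConsensus i)).add (IsQuadratic.sum fun i =>
        ((isHomogeneousMap_snd i).mulVec _).dotProduct ((isHomogeneousMap_snd i).mulVec _))
  · exact fun ξ => add_nonneg (sum_dotProduct_self_nonneg _) (sum_dotProduct_self_nonneg _)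
  · intro ξ hξ h0
    have h1 := sum_dotProduct_self_nonneg fun i => D.errorConsensus ξ i
    have h2 := sum_dotProduct_self_nonneg fun i => (D.Td i)ᵀ *ᵥ ξ.2 i
    -- On the zero set of g every estimate is exact, so every controller applies K^ι x and the plant
    -- moves under the stabilizing state feedback.
    have he0 : ξ.2 = 0 := eq_zero_of_errorConsensus hD hdet hgraph
      (eq_zero_of_sum_dotProduct_self (by linarith))
      (eq_zero_of_sum_dotProduct_self (by linarith))
    have hx0 : ξ.1 ≠ 0 := fun h => hξ (Prod.ext h he0)
    have hplant : plantField K σ ξ = (S.A + ∑ ι, S.Bc ι * K ι) *ᵥ ξ.1 := by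
      simp only [plantField, Network.inputTerm, errorFeedback, he0, Pi.zero_apply, add_zero,
        Matrix.add_mulVec, Matrix.sum_mulVec, Matrix.mulVec_mulVec]
    have hpos : 0 < ξ.1 ⬝ᵥ ξ.1 := lt_of_le_of_ne (dotProduct_self_nonneg_real _)
      fun h => hx0 (dotProduct_self_eq_zero.1 h.symm)
    have := hP ξ.1
    rw [← hplant] at this
    simp only [laplacian, he0, Pi.zero_apply, sub_zero, smul_zero, Finset.sum_const_zero,
      zero_dotProduct, zero_add]
    linarith

/-- The energy grows at most exponentially along trajectories. -/
theorem IsTrajectory.exists_energy_growth (hS : S.Standing) (hgraph : IsConnectedAdjacency S.a)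
    (hD : D.Admissible) (hdet : D.CollectivelyStronglyDetectable)
    (htraj : D.IsTrajectory K σ x z γ γs) :
    ∃ C > 0, ∀ᵐ t : ℝ, 0 < t → ∃ d ≤ C * D.energy (D.errorState x z t),
      HasDerivAt (fun t => D.energy (D.errorState x z t)) d t := by
  have he := isHomogeneousMap_snd (n := n) (N := N)
  obtain ⟨C, hC, hle⟩ := exists_le_mul (f := fun ξ => 2 * (ξ.1 ⬝ᵥ plantField K σ ξ)
      + ((∑ i, laplacian S.a ξ.2 i ⬝ᵥ D.errorField K σ ξ i)
      + ∑ i, 2 * (((D.Td i)ᵀ *ᵥ ξ.2 i) ⬝ᵥ D.E i *ᵥ ((D.Td i)ᵀ *ᵥ ξ.2 i))))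
    (((isHomogeneousMap_fst.dotProduct (isHomogeneousMap_plantField K σ)).const_mul 2).add
      ((IsQuadratic.sum fun i => (isHomogeneousMap_laplacian S.a i).dotProduct
        (D.isHomogeneousMap_errorField K σ i)).add
        (IsQuadratic.sum fun i =>
          (((he i).mulVec _).dotProduct (((he i).mulVec _).mulVec _)).const_mul 2)))
    D.isQuadratic_energy fun ξ hξ => energy_pos hgraph hdet hξ
  refine ⟨C, hC, ?_⟩
  filter_upwards [htraj.closedLoopAt hS hD] with t ht h0
  obtain ⟨s, hs⟩ := ht h0
  refine ⟨_, ?_, (hasDerivAt_dotProduct hs.plant hs.plant).add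
    ((hs.hasDerivAt_disagreement hgraph.1).add (HasDerivAt.fun_sum fun i _ =>
      hasDerivAt_dotProduct (hs.hasDerivAt_local hD i) (hs.hasDerivAt_local hD i)))⟩
  refine le_trans ?_ (hle (D.errorState x z t))
  refine add_le_add (le_of_eq ?_) (add_le_add (Finset.sum_le_sum fun i _ => ?_)
    (Finset.sum_le_sum fun i _ => le_of_eq ?_))
  · rw [dotProduct_comm, two_mul]
    rfl
  -- The coupling contributes -(γ_i ‖ε_{iu}‖² + γ_{is} ‖ε_{iu}‖) ≤ 0 and is dropped. The growth
  -- constant thus does not depend on the gains.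
  · obtain ⟨h1, h2⟩ := htraj.gains_pos hD i h0.le
    exact sub_le_self _ (add_nonneg (mul_nonneg h1.le (sq_nonneg _))
      (mul_nonneg h2.le (enorm2_nonneg _)))
  · rw [dotProduct_comm, two_mul]
    rfl

/-- The storage of the plant, the disagreement and the locally reconstructed errors. -/
noncomputable def stateStorage (D : Design S) (P : Matrix (Fin n) (Fin n) ℝ)
    (Q : ∀ i, Matrix (Fin (D.δ i)) (Fin (D.δ i)) ℝ) (k : ℝ) (x : ℝ → Fin n → ℝ)
    (z : Fin N → ℝ → Fin n → ℝ) (t : ℝ) : ℝ :=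
  1 / 2 * (∑ i, D.error x z i t ⬝ᵥ laplacian S.a (fun j => D.error x z j t) i)
    + x t ⬝ᵥ P *ᵥ x t
    + k * (∑ i, ((D.Td i)ᵀ *ᵥ D.error x z i t) ⬝ᵥ Q i *ᵥ ((D.Td i)ᵀ *ᵥ D.error x z i t))

/-- The storage of the adaptive gains, relative to the gain level `k`. -/
noncomputable def gainStorage (D : Design S) (k : ℝ) (γ γs : Fin N → ℝ → ℝ) (t : ℝ) : ℝ :=
  (∑ i, (γ i t - k) ^ 2 / (2 * D.φ i)) + ∑ i, γs i t ^ 2 / (2 * D.φs i)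

theorem stateStorage_nonneg (hgraph : IsConnectedAdjacency S.a) {P : Matrix (Fin n) (Fin n) ℝ}
    {Q : ∀ i, Matrix (Fin (D.δ i)) (Fin (D.δ i)) ℝ} {k : ℝ} (hP : ∀ v, 0 ≤ v ⬝ᵥ P *ᵥ v)
    (hQ : ∀ i v, 0 ≤ v ⬝ᵥ Q i *ᵥ v) (hk : 0 ≤ k) (t : ℝ) :
    0 ≤ D.stateStorage P Q k x z t :=
  add_nonneg (add_nonneg (half_sum_dotProduct_laplacian_nonneg hgraph _) (hP _))
    (mul_nonneg hk (Finset.sum_nonneg fun i _ => hQ i _))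

theorem Admissible.gain_term_nonneg (hD : D.Admissible) (k : ℝ) (i : Fin N) (t : ℝ) :
    0 ≤ (γ i t - k) ^ 2 / (2 * D.φ i) :=
  div_nonneg (sq_nonneg _) (mul_nonneg zero_le_two (hD.φ_pos i).le)

theorem Admissible.gains_term_nonneg (hD : D.Admissible) (i : Fin N) (t : ℝ) :
    0 ≤ γs i t ^ 2 / (2 * D.φs i) :=
  div_nonneg (sq_nonneg _) (mul_nonneg zero_le_two (hD.φs_pos i).le)

theorem Admissible.gainStorage_nonneg (hD : D.Admissible) (k : ℝ) (t : ℝ) :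
    0 ≤ D.gainStorage k γ γs t :=
  add_nonneg (Finset.sum_nonneg fun i _ => hD.gain_term_nonneg k i t)
    (Finset.sum_nonneg fun i _ => hD.gains_term_nonneg i t)

theorem Admissible.gain_term_le (hD : D.Admissible) (k : ℝ) (i : Fin N) (t : ℝ) :
    (γ i t - k) ^ 2 / (2 * D.φ i) ≤ D.gainStorage k γ γs t :=
  (Finset.single_le_sum (f := fun i => (γ i t - k) ^ 2 / (2 * D.φ i))
    (fun j _ => hD.gain_term_nonneg k j t) (Finset.mem_univ i)).trans
    (le_add_of_nonneg_right (Finset.sum_nonneg fun i _ => hD.gains_term_nonneg i t))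

theorem Admissible.gains_term_le (hD : D.Admissible) (k : ℝ) (i : Fin N) (t : ℝ) :
    γs i t ^ 2 / (2 * D.φs i) ≤ D.gainStorage k γ γs t :=
  (Finset.single_le_sum (f := fun i => γs i t ^ 2 / (2 * D.φs i))
    (fun i _ => hD.gains_term_nonneg i t) (Finset.mem_univ i)).trans
    (le_add_of_nonneg_left (Finset.sum_nonneg fun i _ => hD.gain_term_nonneg k i t))

theorem IsTrajectory.energy_ac (htraj : D.IsTrajectory K σ x z γ γs) :
    LocallyAC fun t => D.energy (D.errorState x z t) := by
  have hx := VecLocallyAC.of_absolutelyContinuous htraj.x_ac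
  have he := htraj.error_ac
  have hL := fun i => VecLocallyAC.laplacian (a := S.a) he i
  exact (hx.dotProduct hx).add
    (((LocallyAC.sum _ fun i _ => (he i).dotProduct (hL i)).const_mul _).add
      (LocallyAC.sum _ fun i _ => ((he i).mulVec _).dotProduct ((he i).mulVec _)))

theorem IsTrajectory.stateStorage_ac (htraj : D.IsTrajectory K σ x z γ γs)
    (P : Matrix (Fin n) (Fin n) ℝ) (Q : ∀ i, Matrix (Fin (D.δ i)) (Fin (D.δ i)) ℝ) (k : ℝ) :
    LocallyAC (D.stateStorage P Q k x z) := by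
  have hx := VecLocallyAC.of_absolutelyContinuous htraj.x_ac
  have he := htraj.error_ac
  have hL := fun i => VecLocallyAC.laplacian (a := S.a) he i
  exact (((LocallyAC.sum _ fun i _ => (he i).dotProduct (hL i)).const_mul _).add
    (hx.dotProduct (hx.mulVec P))).add
      ((LocallyAC.sum _ fun i _ =>
        ((he i).mulVec _).dotProduct (((he i).mulVec _).mulVec (Q i))).const_mul k)

theorem IsTrajectory.gainStorage_ac (htraj : D.IsTrajectory K σ x z γ γs) (k : ℝ) :
    LocallyAC (D.gainStorage k γ γs) :=
  (LocallyAC.sum _ fun i _ =>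
    (LocallyAC.sub (htraj.γ_ac i) (LocallyAC.const k)).pow_two.div_const _).add
    (LocallyAC.sum _ fun i _ => (LocallyAC.pow_two (htraj.γs_ac i)).div_const _)

namespace ClosedLoopAt

variable {t : ℝ} {s : ∀ i, Fin (n - D.δ i) → ℝ}

/-- The first sum is what the coupling removes from the disagreement. After cancellation the
adaptive gains act like the constant gain k. The gains γ_{is} need no offset, as no term of first
order in ‖ε_{iu}‖ has to be dominated. -/
theorem hasDerivAt_gainStorage (h : D.ClosedLoopAt K σ x z γ γs t s) (hD : D.Admissible) (k : ℝ) :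
    HasDerivAt (D.gainStorage k γ γs)
      ((∑ i, (γ i t * enorm2 (D.errorConsensus (D.errorState x z t) i) ^ 2
          + γs i t * enorm2 (D.errorConsensus (D.errorState x z t) i)))
        - k * ∑ i, D.errorConsensus (D.errorState x z t) i ⬝ᵥ
          D.errorConsensus (D.errorState x z t) i) t := by
  refine ((HasDerivAt.fun_sum fun i _ =>
    (((h.gain i).sub_const k).pow 2).div_const (2 * D.φ i)).add
    (HasDerivAt.fun_sum fun i _ => ((h.gains i).pow 2).div_const (2 * D.φs i))).congr_deriv ?_
  rw [Finset.mul_sum, ← Finset.sum_add_distrib, ← Finset.sum_sub_distrib]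
  refine Finset.sum_congr rfl fun i _ => ?_
  have h1 := (hD.φ_pos i).ne'
  have h2 := (hD.φs_pos i).ne'
  rw [← enorm2_sq]
  field_simp
  push_cast
  ring

theorem hasDerivAt_stateStorage (h : D.ClosedLoopAt K σ x z γ γs t s) (hD : D.Admissible)
    (ha : ∀ i j, S.a i j = S.a j i) {P : Matrix (Fin n) (Fin n) ℝ} (hP : Pᵀ = P)
    {Q : ∀ i, Matrix (Fin (D.δ i)) (Fin (D.δ i)) ℝ} (hQ : ∀ i, (Q i)ᵀ = Q i) (k : ℝ) :
    HasDerivAt (D.stateStorage P Q k x z)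
      ((∑ i, (laplacian S.a (D.errorState x z t).2 i ⬝ᵥ D.errorField K σ (D.errorState x z t) i
        - (γ i t * enorm2 (D.errorConsensus (D.errorState x z t) i) ^ 2
          + γs i t * enorm2 (D.errorConsensus (D.errorState x z t) i))))
      + 2 * (x t ⬝ᵥ P *ᵥ plantField K σ (D.errorState x z t))
      + k * ∑ i, 2 * (((D.Td i)ᵀ *ᵥ D.error x z i t) ⬝ᵥ
        Q i *ᵥ (D.E i *ᵥ ((D.Td i)ᵀ *ᵥ D.error x z i t)))) t :=
  ((h.hasDerivAt_disagreement ha).add (hasDerivAt_quadratic hP h.plant)).add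
    ((HasDerivAt.fun_sum fun i _ =>
      hasDerivAt_quadratic (hQ i) (h.hasDerivAt_local hD i)).const_mul k)

end ClosedLoopAt

/-! ### Dissipation, convergence and boundedness of the gains. -/

/-- A storage function for the closed loop, which decreases at least at the rate of a multiple
of the energy. -/
theorem IsTrajectory.exists_storage (hS : S.Standing) (hgraph : IsConnectedAdjacency S.a)
    (hD : D.Admissible) (hdet : D.CollectivelyStronglyDetectable)
    (hK : S.StateFeedbackStabilizes K) (htraj : D.IsTrajectory K σ x z γ γs) :
    ∃ (k c : ℝ) (V : ℝ → ℝ), 0 < c ∧ LocallyAC V ∧ (∀ t, D.gainStorage k γ γs t ≤ V t) ∧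
      ∀ᵐ t : ℝ, 0 < t → ∃ d ≤ -(c * D.energy (D.errorState x z t)), HasDerivAt V d t := by
  obtain ⟨P, hPT, hP0, hP⟩ := hK.isHurwitz.exists_lyapunov
  choose Q hQT hQ0 hQ using htraj.exists_local_lyapunov hD
  obtain ⟨k, hk, c, hc, hkc⟩ := exists_gain (σ := σ) hgraph hD hdet hP
  obtain ⟨C, hC, hCle⟩ : ∃ C > 0, ∀ ξ, D.energy ξ ≤ C * ‖ξ‖ ^ 2 := by
    refine exists_le_mul D.isQuadratic_energy ⟨by fun_prop, fun r ξ => ?_⟩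
      fun ξ hξ => by positivity
    rw [norm_smul, mul_pow, Real.norm_eq_abs, sq_abs]
  refine ⟨k, c / C, fun t => D.stateStorage P Q k x z t + D.gainStorage k γ γs t, div_pos hc hC,
    (htraj.stateStorage_ac P Q k).add (htraj.gainStorage_ac k),
    fun t => le_add_of_nonneg_left (stateStorage_nonneg hgraph hP0 hQ0 hk.le t), ?_⟩
  filter_upwards [htraj.closedLoopAt hS hD] with t ht h0
  obtain ⟨s, hs⟩ := ht h0
  refine ⟨_, ?_, (hs.hasDerivAt_stateStorage hD hgraph.1 hPT hQT k).add
    (hs.hasDerivAt_gainStorage hD k)⟩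
  have h1 := hkc (D.errorState x z t)
  have h2 : k * ∑ i, 2 * (((D.Td i)ᵀ *ᵥ D.error x z i t) ⬝ᵥ
      Q i *ᵥ (D.E i *ᵥ ((D.Td i)ᵀ *ᵥ D.error x z i t))) ≤
      k * -∑ i, ((D.Td i)ᵀ *ᵥ (D.errorState x z t).2 i) ⬝ᵥ
        ((D.Td i)ᵀ *ᵥ (D.errorState x z t).2 i) := by
    rw [← Finset.sum_neg_distrib]
    exact mul_le_mul_of_nonneg_left (Finset.sum_le_sum fun i _ => hQ i t h0.le) hk.le
  have h3 : c / C * D.energy (D.errorState x z t) ≤ c * ‖D.errorState x z t‖ ^ 2 := by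
    rw [div_mul_eq_mul_div, div_le_iff₀ hC]
    nlinarith [mul_le_mul_of_nonneg_left (hCle (D.errorState x z t)) hc.le]
  have h4 : (D.errorState x z t).1 = x t := rfl
  rw [h4] at h1
  -- Separating the sums exposes the coupling terms, which cancel against those in the derivative of
  -- the gain storage.
  rw [Finset.sum_sub_distrib]
  linarith

/-- The closed loop is asymptotically stable and its adaptive gains are bounded. -/
theorem IsTrajectory.separation (hS : S.Standing) (hgraph : IsConnectedAdjacency S.a)
    (hD : D.Admissible) (hdet : D.CollectivelyStronglyDetectable)
    (hK : S.StateFeedbackStabilizes K) (htraj : D.IsTrajectory K σ x z γ γs) :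
    Tendsto (fun t => enorm2 (x t)) atTop (𝓝 0) ∧
    (∀ i, Tendsto (fun t => enorm2 (D.error x z i t)) atTop (𝓝 0)) ∧
    (∀ i, ∃ M : ℝ, ∀ t, 0 ≤ t → |γ i t| ≤ M ∧ |γs i t| ≤ M) := by
  obtain ⟨k, c, V, hc, hVac, hVge, hV'⟩ := htraj.exists_storage hS hgraph hD hdet hK
  obtain ⟨C, hC, hW'⟩ := htraj.exists_energy_growth hS hgraph hD hdet
  have hWlim := tendsto_zero_of_dissipation hc hC.le hVac htraj.energy_ac
    (fun t _ => (hD.gainStorage_nonneg k t).trans (hVge t))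
    (fun t _ => energy_nonneg hgraph _) hV' hW'
  have hlim : ∀ {v : (Fin n → ℝ) × (Fin N → Fin n → ℝ) → Fin n → ℝ}, IsHomogeneousMap v →
      Tendsto (fun t => enorm2 (v (D.errorState x z t))) atTop (𝓝 0) := by
    intro v hv
    obtain ⟨C, hC, h⟩ := exists_le_mul (hv.dotProduct hv) D.isQuadratic_energy
      fun ξ hξ => energy_pos hgraph hdet hξ
    refine tendsto_enorm2_of_sq (squeeze_zero (fun t => dotProduct_self_nonneg_real _)
      (fun t => h _) ?_)
    simpa using hWlim.const_mul C
  have hVanti : AntitoneOn V (Set.Ici 0) := hVac.antitoneOn le_rfl <| by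
    filter_upwards [hV'] with t ht h0
    obtain ⟨d, hd, h⟩ := ht h0
    exact ⟨d, hd.trans (neg_nonpos.2 (mul_nonneg hc.le (energy_nonneg hgraph _))), h⟩
  refine ⟨hlim (v := fun ξ => ξ.1) isHomogeneousMap_fst,
    fun i => hlim (v := fun ξ => ξ.2 i) (isHomogeneousMap_snd i), fun i => ?_⟩
  -- Each gain term of the storage is at most V(0), which bounds |γ_i - k| and |γ_{is}| by the two
  -- square roots.
  refine ⟨max (k + √(2 * D.φ i * V 0)) √(2 * D.φs i * V 0), fun t ht => ?_⟩
  have hVt : V t ≤ V 0 := hVanti Set.self_mem_Ici (Set.mem_Ici.2 ht) ht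
  have h1 := ((hD.gain_term_le (γs := γs) k i t).trans (hVge t)).trans hVt
  have h2 := ((hD.gains_term_le (γ := γ) k i t).trans (hVge t)).trans hVt
  rw [div_le_iff₀' (mul_pos two_pos (hD.φ_pos i))] at h1
  rw [div_le_iff₀' (mul_pos two_pos (hD.φs_pos i))] at h2
  refine ⟨le_max_of_le_left ?_, le_max_of_le_right (Real.abs_le_sqrt h2)⟩
  have h3 := Real.abs_le_sqrt h1
  rw [abs_of_pos (htraj.gains_pos hD i ht).1]
  linarith [le_abs_self (γ i t - k)]

end Design
end DistObs

theorem theorem3 {n m N Nc : ℕ} (S : DistObs.Network n m N Nc) (hS : S.Standing)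
    (hstab : DistObs.IsStabilizable S.A S.B)
    (hgraph : DistObs.IsConnectedAdjacency S.a)
    (D : DistObs.Design S) (hD : D.Admissible)
    (hdet : D.CollectivelyStronglyDetectable)
    (K : ∀ ι, Matrix (Fin (S.mc ι)) (Fin n) ℝ)
    (hK : S.StateFeedbackStabilizes K)
    (σ : Fin Nc → Fin N)
    (x : ℝ → Fin n → ℝ) (z : Fin N → ℝ → Fin n → ℝ) (γ γs : Fin N → ℝ → ℝ)
    (htraj : D.IsTrajectory K σ x z γ γs) :
    Tendsto (fun t => DistObs.enorm2 (x t)) atTop (𝓝 0) ∧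
    (∀ i, Tendsto (fun t => DistObs.enorm2 (D.estimate (x t) (fun j => z j t) i - x t))
      atTop (𝓝 0)) ∧
    (∀ i, ∃ M : ℝ, ∀ t, 0 ≤ t → |γ i t| ≤ M ∧ |γs i t| ≤ M) :=
  htraj.separation hS hgraph hD hdet hK
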